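/- Let $\mathbb F=\mathbb C(q^{1/2})$, $[m]=\frac{q^m-q^{-m}}{q-q^{-1}}$, and set $\mathsf q=q^2$, $[m]_{\mathsf q}=\frac{\mathsf q^m-1}{\mathsf q-1}$, $[l]_{\mathsf q}!=[l]_{\mathsf q}\cdots[1]_{\mathsf q}$, $\binom{m}{l}_{\mathsf q}=\frac{[m]_{\mathsf q}[m-1]_{\mathsf q}\cdots[m-l+1]_{\mathsf q}}{[l]_{\mathsf q}!}$ ($m\in\mathbb Z$, $l\ge 0$). Let $K(1)$ be the polynomial algebra over $\mathbb F$ in variables $a(-r)$, $r\ge 1$, on which $a(-r)$ acts by multiplication and $a(r)$ acts as the derivation with $[a(r),a(-s)]=\delta_{rs}\frac{[2r][r]}{r}$. Let $L_0=K(1)\otimes\mathbb F[\mathbb Z\alpha]$, $(\alpha,\alpha)=2$, and let $$x(z)=\exp\Big(\sum_{r\ge1}\tfrac{q^{-r/2}}{[r]}a(-r)z^r\Big)\exp\Big(-\sum_{r\ge1}\tfrac{q^{-r/2}}{[r]}a(r)z^{-r}\Big)\otimes e^{\alpha}z^{\partial_\alpha},\qquad z^{\partial_\alpha}e^{k\alpha}=z^{2k}e^{k\alpha},$$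 be the Frenkel--Jing operator, an element of $\mathcal E(L_0)=\mathrm{Hom}(L_0,L_0((z)))$. For series $a(z)$ put $a^{[1]}(z)=\frac{a(z\mathsf q)-a(z)}{z(\mathsf q-1)}$ and let $a^{[n]}$ be its $n$-fold iterate. For $a(z),b(z)\in\mathcal E(L_0)$ that are quasi-commutative, i.e. $a(z_1)b(z_2)\in\mathrm{Hom}(L_0,L_0((z_1,z_2)))$, put $a(z)_r b(z)=0$ for $r\ge 0$ and $a(z)_r b(z)=\frac{1}{[-r-1]_{\mathsf q}!}a^{[-r-1]}(z)\,b(z\mathsf q^{-r-1})$ for $r<0$. A nonlocal $\mathsf q$-vertex algebra in $\mathcal E(L_0)$ is a subspace $V\ni 1=1_{L_0}$ all of whose pairs are quasi-commutative, which is closed under all these products, and such that $Y(a(z),z_0)b(z)=\sum_r a(z)_r b(z)\,z_0^{-r-1}$ is linear in $a(z)$ and in $b(z)$ and satisfies, for $a,b,c\in V$: $a(z)_rb(z)=0$ for $r$ large; $Y(1,z_0)=1_V$; $Y(a(z),z_0)1\in V[[z_0]]$ with constant term $a(z)$; and $$Y(a(z),z_0+z_2)Y(b(z),z_2)c(z)=Y(Y(a(z),z_0)b(z),z_2)c(z)$$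 for variables with $z_2z_0=\mathsf q z_0z_2$, $z_2z=\mathsf q zz_2$, $z_0z=\mathsf q zz_0$. Here the left side is $\sum_{r,s}a(z)_r(b(z)_sc(z))\,z_2^{-s-1}(z_0+z_2)^{-r-1}$ with $(z_0+z_2)^m=\sum_{l\ge0}\binom{m}{l}_{\mathsf q}z_0^{m-l}z_2^l$, and the right side is $\sum_{r,s}(a(z)_rb(z))_s\,c(z\mathsf q^{-r-1})\,z_0^{-r-1}z_2^{-s-1}$. Let $\langle x(z)\rangle$ be the intersection of all nonlocal $\mathsf q$-vertex algebras in $\mathcal E(L_0)$ that contain $x(z)$, and let $W_{0,\mathsf q}$ be the $\mathbb F$-span of the monomials $x(z)_{l_m}\cdots x(z)_{l_1}1$ with $m\ge0$ and all $l_j\le-1$. **Theorem.** 1. $\langle x(z)\rangle$ is the smallest nonlocal $\mathsf q$-vertex algebra in $\mathcal E(L_0)$ that contains $x(z)$, and $W_{0,\mathsf q}\subseteq\langle x(z)\rangle$. 2. The monomials $x(z)_{l_m}\cdots x(z)_{l_1}1$ with $m\ge 0$, $l_1\le-1$ and $l_r\le-3$ for $r=2,\dots,m$ form an $\mathbb F$-basis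 of $W_{0,\mathsf q}$ (different index sequences give different basis elements). 3. For $m\ge0$ and integers $l_m<\dots<l_1$, the normally ordered products $$:x(z\mathsf q^{l_m})\cdots x(z\mathsf q^{l_1}):\;=\prod_{j}\exp\Big(\sum_{r\ge1}\tfrac{q^{-r/2}}{[r]}a(-r)(z\mathsf q^{l_j})^r\Big)\prod_{j}\exp\Big(-\sum_{r\ge1}\tfrac{q^{-r/2}}{[r]}a(r)(z\mathsf q^{l_j})^{-r}\Big)\otimes e^{m\alpha}\prod_j(z\mathsf q^{l_j})^{\partial_\alpha}$$ (the identity for $m=0$) are linearly independent over $\mathbb F$. -/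

import Mathlib

noncomputable section

namespace QVA

/-! ### Quantum calculus -/

section Quantum

variable {F : Type*} [Field F]

/-- The integer `[m]_q = (q^m - 1) / (q - 1)`. -/
def qInt (q : F) (m : ℤ) : F := (q ^ m - 1) / (q - 1)

/-- `[l]_q! = [l]_q ⋯ [1]_q`. -/
def qFact (q : F) (l : ℕ) : F := ∏ k ∈ Finset.range l, qInt q (k + 1)

/-- The binomial coefficient `[m]_q [m-1]_q ⋯ [m-l+1]_q / [l]_q!`, for `m ∈ ℤ` and `l ≥ 0`. -/
def qBinom (q : F) (m : ℤ) (l : ℕ) : F := (∏ k ∈ Finset.range l, qInt q (m - k)) / qFact q l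

/-- The symmetric integer `[m] = (q^m - q^{-m}) / (q - q^{-1})`. -/
def qIntSymm (q : F) (m : ℤ) : F := (q ^ m - q ^ (-m)) / (q - q⁻¹)

end Quantum

/-! ### Formal series of operators -/

section Series

variable {F : Type*} [Field F] {L : Type*} [AddCommGroup L] [Module F L]

/-- `(End L)[[z, z⁻¹]]`; the value `a n` is the coefficient of `z ^ n` in `a(z)`. -/
abbrev OpSeries (F : Type*) [Field F] (L : Type*) [AddCommGroup L] [Module F L] : Type _ :=
  ℤ → Module.End F L

/-- `ℰ(L) = Hom(L, L((z)))`, inside `(End L)[[z, z⁻¹]]`. -/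
def fieldSpace (F : Type*) [Field F] (L : Type*) [AddCommGroup L] [Module F L] :
    Submodule F (OpSeries F L) where
  carrier := {a | ∀ v : L, ∃ N : ℤ, ∀ n < N, a n v = 0}
  zero_mem' := fun _ => ⟨0, fun _ _ => rfl⟩
  add_mem' := by
    intro a b ha hb v
    obtain ⟨M, hM⟩ := ha v
    obtain ⟨N, hN⟩ := hb v
    refine ⟨min M N, fun n hn => ?_⟩
    have h1 := hM n (lt_of_lt_of_le hn (min_le_left _ _))
    have h2 := hN n (lt_of_lt_of_le hn (min_le_right _ _))
    simp [h1, h2]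
  smul_mem' := by
    intro c a ha v
    obtain ⟨N, hN⟩ := ha v
    exact ⟨N, fun n hn => by simp [hN n hn]⟩

/-- The identity `1 = 1_L`, as a constant series. -/
def idSeries (F : Type*) [Field F] (L : Type*) [AddCommGroup L] [Module F L] : OpSeries F L :=
  fun n => if n = 0 then LinearMap.id else 0

/-- The series `a(z β)`. -/
def scale (β : F) (a : OpSeries F L) : OpSeries F L := fun n => β ^ n • a n

/-- The `q`-derivation `a^{[1]}(z) = (a(zq) - a(z)) / (z (q - 1))`. -/
def qDeriv (q : F) (a : OpSeries F L) : OpSeries F L :=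
  fun n => (q - 1)⁻¹ • (scale q a (n + 1) - a (n + 1))

open Classical in
/-- The product `a(z) b(z)`: its coefficient of `z ^ n` is `v ↦ ∑ᵢ a i (b (n - i) v)`. It is
meant for series for which all these sums have finitely many nonzero terms, and a coefficient
for which this fails is set to be `0`. -/
def mulSeries (a b : OpSeries F L) : OpSeries F L := fun n =>
  if h : ∀ v : L, (Function.support fun i : ℤ => a i (b (n - i) v)).Finite then
    { toFun := fun v => ∑ᶠ i : ℤ, a i (b (n - i) v)
      map_add' := fun v w => by
        rw [← finsum_add_distrib (h v) (h w)]
        exact finsum_congr fun i => by simp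
      map_smul' := fun c v => by
        simp only [map_smul, RingHom.id_apply]
        rw [smul_finsum' c (h v)] }
  else 0

/-- The pair `(a(z), b(z))` is quasi-commutative: `a(z₁) b(z₂) ∈ Hom(L, L((z₁, z₂)))`. -/
def QuasiCommutative (a b : OpSeries F L) : Prop :=
  ∀ v : L, ∃ N : ℤ, ∀ i j : ℤ, i < N ∨ j < N → a i (b j v) = 0

/-- The `r`th product `a(z)_r b(z)` of a quasi-commutative pair: `0` for `r ≥ 0`, and
`(1 / [-r-1]_q!) a^{[-r-1]}(z) b(z q^{-r-1})` for `r < 0`. -/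
def rProd (q : F) (a : OpSeries F L) (r : ℤ) (b : OpSeries F L) : OpSeries F L :=
  if 0 ≤ r then 0
  else (qFact q (-r - 1).toNat)⁻¹ •
    mulSeries ((qDeriv q)^[(-r - 1).toNat] a) (scale (q ^ (-r - 1)) b)

/-- `(V, Y, e)` is a nonlocal `q`-vertex algebra, where `V ⊆ ℰ(L)`, `Y(a(z), z₀) b(z)` is
`∑ᵣ (Y a r b) z₀^{-r-1}` and `e` is the vacuum vector. The axiom `assoc` is
`Y(a(z), z₀ + z₂) Y(b(z), z₂) c(z) = Y(Y(a(z), z₀) b(z), z₂) c(z)` for variables with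
`z₂ z₀ = q z₀ z₂`, `z₂ z = q z z₂`, `z₀ z = q z z₀`; it compares the coefficients of
`z₀ ^ i z₂ ^ j` of
`∑ᵣₛ a_r (b_s c(z)) z₂^{-s-1} (z₀ + z₂)^{-r-1}` and
`∑ᵣₛ (a_r b)_s z₀^{-r-1} c(z) z₂^{-s-1} = ∑ᵣₛ (a_r b)_s c(z q^{-r-1}) z₀^{-r-1} z₂^{-s-1}`,
where `(z₀ + z₂) ^ m = ∑ₗ [m choose l]_q z₀ ^ (m - l) z₂ ^ l`. Since `c(z q^{-r-1})` need not be in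
`V`, the products are given on all series, and only their restrictions to `V` have to be linear
with values in `V`. -/
structure IsNonlocalQVertexAlgebra (q : F) (V : Submodule F (OpSeries F L))
    (Y : OpSeries F L → ℤ → OpSeries F L → OpSeries F L) (e : OpSeries F L) : Prop where
  le_fieldSpace : V ≤ fieldSpace F L
  vacuum_mem : e ∈ V
  closed : ∀ a ∈ V, ∀ b ∈ V, ∀ r : ℤ, Y a r b ∈ V
  linear_left : ∀ a ∈ V, ∀ a' ∈ V, ∀ b ∈ V, ∀ (k : F) (r : ℤ),
    Y (k • a + a') r b = k • Y a r b + Y a' r b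
  linear_right : ∀ a ∈ V, ∀ b ∈ V, ∀ b' ∈ V, ∀ (k : F) (r : ℤ),
    Y a r (k • b + b') = k • Y a r b + Y a r b'
  truncation : ∀ a ∈ V, ∀ b ∈ V, ∃ N : ℤ, ∀ r ≥ N, Y a r b = 0
  vacuum : ∀ b ∈ V, ∀ r : ℤ, Y e r b = if r = -1 then b else 0
  creation : ∀ a ∈ V, (∀ r ≥ 0, Y a r e = 0) ∧ Y a (-1) e = a
  assoc : ∀ a ∈ V, ∀ b ∈ V, ∀ c ∈ V, ∀ i j : ℤ,
    ∑ᶠ l : ℕ, (q ^ ((j - l) * i) * qBinom q (i + l) l) •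
        Y a (-(i + l) - 1) (Y b (-(j - l) - 1) c) =
      Y (Y a (-i - 1) b) (-j - 1) (scale (q ^ i) c)

/-- `V ⊆ ℰ(L)` is a nonlocal `q`-vertex algebra with respect to the `r`th products (which are
defined for quasi-commutative pairs) and with the vacuum vector `1_L`. -/
def IsQVertexAlgebraOfFields (q : F) (V : Submodule F (OpSeries F L)) : Prop :=
  (∀ a ∈ V, ∀ b ∈ V, QuasiCommutative a b) ∧
    IsNonlocalQVertexAlgebra q V (rProd q) (idSeries F L)

/-- `⟨S⟩`: the intersection of all nonlocal `q`-vertex algebras in `ℰ(L)` that contain `S`. -/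
def generated (q : F) (S : Set (OpSeries F L)) : Submodule F (OpSeries F L) :=
  sInf {V | S ⊆ V ∧ IsQVertexAlgebraOfFields q V}

/-- The monomial `a(z)_{l_m} ⋯ a(z)_{l_1} 1` for the list `[l_m, …, l_1]`. -/
def monomial (q : F) (a : OpSeries F L) (l : List ℤ) : OpSeries F L :=
  l.foldr (fun r b => rProd q a r b) (idSeries F L)

end Series

/-! ### The Frenkel-Jing operator -/

/-- The field `ℂ(q^{1/2})`. -/
abbrev Scalars : Type := RatFunc ℂ

/-- The indeterminate `q^{1/2}`. -/
def sqrtq : Scalars := RatFunc.X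

/-- The element `q`. -/
def q₀ : Scalars := sqrtq ^ 2

/-- The parameter `q²` of the nonlocal vertex algebra. -/
def qq : Scalars := q₀ ^ 2

/-- `K(1)`: the symmetric algebra on the elements `a(-r)`, `r ≥ 1`; the variable `X r` is
`a(-r)`. -/
abbrev Fock : Type := MvPolynomial ℕ+ Scalars

/-- The action of `a(-r)`, `r ≥ 1`, on `K(1)`. -/
def creator (r : ℕ+) : Module.End Scalars Fock := LinearMap.mulLeft Scalars (MvPolynomial.X r)

/-- The action of `a(r)`, `r ≥ 1`, on `K(1)`: the derivation with
`[a(r), a(-s)] = δ_{rs} [2r] [r] / r`. -/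
def annihilator (r : ℕ+) : Module.End Scalars Fock :=
  (qIntSymm q₀ (2 * r) * qIntSymm q₀ r / (r : ℕ)) • (MvPolynomial.pderiv r).toLinearMap

/-- The coefficient of `w ^ k` in `exp f(w) = ∑ₙ f(w)ⁿ / n!`, for a power series `f` over `End K(1)`
with `f(0) = 0`; then `f(w)ⁿ` does not contribute for `n > k`. -/
def expCoeff (f : PowerSeries (Module.End Scalars Fock)) (k : ℕ) : Module.End Scalars Fock :=
  ∑ n ∈ Finset.range (k + 1), ((n.factorial : Scalars)⁻¹) • PowerSeries.coeff k (f ^ n)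

/-- `exp (∑_{r ≥ 1} (q^{-r/2} / [r]) p(r) a(-r) z^r)`. For `p = 1` this is `E₋⁺(-a, z)`, and
replacing `z` by `z β` amounts to `p(r) = β^r`. -/
def expMinus (p : ℕ → Scalars) : OpSeries Scalars Fock := fun n =>
  if 0 ≤ n then
    expCoeff (PowerSeries.mk fun r : ℕ =>
      if h : 0 < r then (sqrtq ^ (-(r : ℤ)) / qIntSymm q₀ r * p r) • creator ⟨r, h⟩ else 0) n.toNat
  else 0

/-- `exp (- ∑_{r ≥ 1} (q^{-r/2} / [r]) p(r) a(r) z^{-r})`. For `p = 1` this is `E₊⁺(-a, z)`, and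
replacing `z` by `z β` amounts to `p(r) = β^{-r}`. -/
def expPlus (p : ℕ → Scalars) : OpSeries Scalars Fock := fun n =>
  if n ≤ 0 then
    expCoeff (PowerSeries.mk fun r : ℕ =>
      if h : 0 < r then -(sqrtq ^ (-(r : ℤ)) / qIntSymm q₀ r * p r) • annihilator ⟨r, h⟩ else 0)
      (-n).toNat
  else 0

/-- `L₀ = K(1) ⊗ ℂ{Q}`, `Q = ℤ α`, as the direct sum of the spaces `K(1) ⊗ e^{kα}`, `k ∈ ℤ`. -/
abbrev L₀ : Type := ℤ →₀ Fock

/-- The Frenkel-Jing operator `x(z) = x⁺(z) = E₋⁺(-a, z) E₊⁺(-a, z) ⊗ e^α z^{∂_α}` on `L₀`, where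
`z^{∂_α} e^{kα} = z^{2k} e^{kα}`. -/
def frenkelJing : OpSeries Scalars L₀ := fun n =>
  Finsupp.lsum Scalars fun k : ℤ =>
    (Finsupp.lsingle (k + 1) : Fock →ₗ[Scalars] L₀) ∘ₗ
      mulSeries (expMinus fun _ => 1) (expPlus fun _ => 1) (n - 2 * k)

/-- The normally ordered product `:x(z qq^{l_m}) ⋯ x(z qq^{l_1}):` for the set of shifts
`s = {l_1, …, l_m}`. It is
`(∏ₗ E₋⁺(-a, z qq^l)) (∏ₗ E₊⁺(-a, z qq^l)) ⊗ e^{mα} ∏ₗ (z qq^l)^{∂_α}`, where both products of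
exponentials, having commuting exponents, are written as one exponential, and the last factor
multiplies `e^{kα}` by `qq^{2k (l_1 + ⋯ + l_m)} z^{2km}`. -/
def normalOrdered (s : Finset ℤ) : OpSeries Scalars L₀ := fun n =>
  Finsupp.lsum Scalars fun k : ℤ =>
    (Finsupp.lsingle (k + s.card) : Fock →ₗ[Scalars] L₀) ∘ₗ
      (qq ^ (2 * k * ∑ l ∈ s, l) •
        mulSeries (expMinus fun r => ∑ l ∈ s, qq ^ (l * r)) (expPlus fun r => ∑ l ∈ s, qq ^ (-(l * r)))
          (n - 2 * k * s.card))

/-- `⟨x(z)⟩`. -/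
def xAlgebra : Submodule Scalars (OpSeries Scalars L₀) := generated qq {frenkelJing}

/-- `W_{0,qq}`: the span of the monomials `x(z)_{l_m} ⋯ x(z)_{l_1} 1`, `l_j ≤ -1`, `m ≥ 0`. -/
def W₀ : Submodule Scalars (OpSeries Scalars L₀) :=
  Submodule.span Scalars {a | ∃ l : List ℤ, (∀ k ∈ l, k ≤ -1) ∧ a = monomial qq frenkelJing l}

/-- The condition on `[l_m, …, l_1]` that `l_1 ≤ -1` and `l_r ≤ -3` for `r = 2, …, m`. -/
def Admissible (l : List ℤ) : Prop := (∀ k ∈ l, k ≤ -1) ∧ ∀ k ∈ l.dropLast, k ≤ -3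

end QVA

end

/-!
For a multiset `s` of integers let `N(s) = :∏_{l ∈ s} x(z qq^l):` (`vertexOp s`). The commutation
relation `[a(r), a(-r)] = [2r][r]/r` gives the two-variable normal ordering
`E₊(z₁) E₋(z₂) = ∏ (1 - qq^{b-a} z₂/z₁) (1 - qq^{b-a-1} z₂/z₁) E₋(z₂) E₊(z₁)`, over `a ∈ s` and
`b ∈ t`. The factor is a polynomial in `z₂/z₁`, so that `N(s)` and `N(t)` are quasi-commutative, and
setting `z₁ = z₂ = z` gives `N(s) N(t) = γ(s, t) z^{2|s||t|} N(s + t)` with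
`γ(s, t) = ∏ (qq^a - qq^b) (qq^a - qq^{b-1})` (`vertexOp_mulSeries_vertexOp`).

Existence. Since `γ` is multiplicative in both arguments, the span of all `z^k N(s)` is an
associative algebra of pairwise quasi-commutative fields, stable under `z ↦ z qq` and under the
`q`-derivation (`isFieldAlgebra_vertexSpan`). Every such algebra is a nonlocal `q`-vertex algebra:
the associativity axiom is the `q`-Leibniz rule for divided powers of the `q`-derivation
(`IsFieldAlgebra.qDivDeriv_mul`, `IsFieldAlgebra.isQVertexAlgebraOfFields`). So the intersection
that defines `⟨x(z)⟩` is over a nonempty family, and it is its least member (`isLeast_generated`).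

Independence of normally ordered products. Applied to the vacuum, `z^k N(s)` becomes
`z^k E₋ 1`, which is a joint eigenvector of the commuting operators `z^{-r} ∂_r`. The eigenvalues
are nonzero multiples of the power sums `∑_{l ∈ s} qq^{lr}`, which determine `s` because `qq` is not
a root of unity. Hence all `z^k N(s)` are linearly independent
(`linearIndependent_shiftedVertexOp`).

Basis. Order the terms `z^k N(s)` by the sum of `s`. The `q`-derivation does not change the shifts
of a leading term, the substitution `z ↦ z qq` raises all of them by `1`, and leading terms multiply
as long as `γ` does not vanish. With `n_j = -l_j - 1`, the monomial `x(z)_{l_m} ⋯ x(z)_{l_1} 1` thus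
has the shifts `0, n_m, n_m + n_{m-1}, …` in its leading term, provided that `n_j ≥ 2` for `j ≥ 2`:
the factor `γ({0}, s)` is nonzero when all elements of `s` are at least `2`
(`hasLeadingTerm_monomial`). Leading terms of different admissible monomials are different
(`leadingIndex_injective`), which gives their independence (`linearIndependent_monomial`).
For the spanning property, `γ({0}, {0}) = γ({0}, {1}) = γ({1}, {1}) = 0` gives
`x(z)_{-1} x(z) = x(z)_{-2} x(z) = 0`, and associativity turns these into relations that rewrite an
outer index `-2` or `-1` in terms of smaller ones (`monomial_mem_admissibleSpan`).
-/

noncomputable section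

namespace QVA

/-! ### Products of formal series of operators -/

section Calculus

variable {F : Type*} [Field F] {L : Type*} [AddCommGroup L] [Module F L]

local infixl:70 " ⋆ " => mulSeries

/-- The series `z ^ k a(z)`. -/
def zMul (k : ℤ) (a : OpSeries F L) : OpSeries F L := fun n => a (n - k)

namespace QuasiCommutative

variable {a a' b b' : OpSeries F L}

theorem finite_support (h : QuasiCommutative a b) (n : ℤ) (v : L) :
    (Function.support fun i : ℤ => a i (b (n - i) v)).Finite := by
  obtain ⟨N, hN⟩ := h v
  refine (Set.finite_Icc N (n - N)).subset fun i hi => ?_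
  by_contra hc
  refine hi (hN i (n - i) ?_)
  simp only [Set.mem_Icc] at hc
  omega

theorem zero_left : QuasiCommutative (0 : OpSeries F L) b := fun _ => ⟨0, fun _ _ _ => rfl⟩

theorem zero_right : QuasiCommutative a (0 : OpSeries F L) :=
  fun _ => ⟨0, fun _ _ _ => map_zero _⟩

theorem add_left (h : QuasiCommutative a b) (h' : QuasiCommutative a' b) :
    QuasiCommutative (a + a') b := fun v => by
  obtain ⟨N, hN⟩ := h v
  obtain ⟨N', hN'⟩ := h' v
  refine ⟨min N N', fun i j hij => ?_⟩
  simp [hN i j (by omega), hN' i j (by omega)]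

theorem add_right (h : QuasiCommutative a b) (h' : QuasiCommutative a b') :
    QuasiCommutative a (b + b') := fun v => by
  obtain ⟨N, hN⟩ := h v
  obtain ⟨N', hN'⟩ := h' v
  refine ⟨min N N', fun i j hij => ?_⟩
  simp [hN i j (by omega), hN' i j (by omega)]

theorem smul_left (h : QuasiCommutative a b) (c : F) : QuasiCommutative (c • a) b := fun v => by
  obtain ⟨N, hN⟩ := h v
  exact ⟨N, fun i j hij => by simp [hN i j hij]⟩

theorem smul_right (h : QuasiCommutative a b) (c : F) : QuasiCommutative a (c • b) := fun v => by
  obtain ⟨N, hN⟩ := h v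
  exact ⟨N, fun i j hij => by simp [hN i j hij]⟩

theorem zMul_zMul (h : QuasiCommutative a b) (k l : ℤ) :
    QuasiCommutative (zMul k a) (zMul l b) := fun v => by
  obtain ⟨N, hN⟩ := h v
  exact ⟨N + min k l, fun i j hij => hN _ _ (by omega)⟩

end QuasiCommutative

theorem mulSeries_apply {a b : OpSeries F L} (h : QuasiCommutative a b) (n : ℤ) (v : L) :
    (a ⋆ b) n v = ∑ᶠ i : ℤ, a i (b (n - i) v) := by
  rw [mulSeries, dif_pos (h.finite_support n)]
  rfl

theorem add_mulSeries {a a' b : OpSeries F L} (h : QuasiCommutative a b)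
    (h' : QuasiCommutative a' b) : (a + a') ⋆ b = a ⋆ b + a' ⋆ b := by
  ext n v
  rw [mulSeries_apply (h.add_left h'), Pi.add_apply, LinearMap.add_apply, mulSeries_apply h,
    mulSeries_apply h', ← finsum_add_distrib (h.finite_support n v) (h'.finite_support n v)]
  rfl

theorem mulSeries_add {a b b' : OpSeries F L} (h : QuasiCommutative a b)
    (h' : QuasiCommutative a b') : a ⋆ (b + b') = a ⋆ b + a ⋆ b' := by
  ext n v
  rw [mulSeries_apply (h.add_right h'), Pi.add_apply, LinearMap.add_apply, mulSeries_apply h,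
    mulSeries_apply h', ← finsum_add_distrib (h.finite_support n v) (h'.finite_support n v)]
  exact finsum_congr fun i => by simp

theorem smul_mulSeries {a b : OpSeries F L} (h : QuasiCommutative a b) (c : F) :
    (c • a) ⋆ b = c • (a ⋆ b) := by
  ext n v
  rw [mulSeries_apply (h.smul_left c), Pi.smul_apply, LinearMap.smul_apply, mulSeries_apply h,
    smul_finsum' c (h.finite_support n v)]
  rfl

theorem mulSeries_smul {a b : OpSeries F L} (h : QuasiCommutative a b) (c : F) :
    a ⋆ (c • b) = c • (a ⋆ b) := by
  ext n v
  rw [mulSeries_apply (h.smul_right c), Pi.smul_apply, LinearMap.smul_apply, mulSeries_apply h,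
    smul_finsum' c (h.finite_support n v)]
  exact finsum_congr fun i => by simp

theorem zero_mulSeries (b : OpSeries F L) : (0 : OpSeries F L) ⋆ b = 0 := by
  ext n v
  simp [mulSeries_apply QuasiCommutative.zero_left]

theorem mulSeries_zero (a : OpSeries F L) : a ⋆ (0 : OpSeries F L) = 0 := by
  ext n v
  simp [mulSeries_apply QuasiCommutative.zero_right]

theorem zMul_mulSeries_zMul {a b : OpSeries F L} (h : QuasiCommutative a b) (k l : ℤ) :
    zMul k a ⋆ zMul l b = zMul (k + l) (a ⋆ b) := by
  ext n v
  rw [mulSeries_apply (h.zMul_zMul k l), zMul, mulSeries_apply h]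
  refine finsum_eq_of_bijective (fun i => i - k) (Equiv.subRight k).bijective fun i => ?_
  simp only [zMul]
  congr 3
  ring

theorem zMul_zero (a : OpSeries F L) : zMul 0 a = a := by
  ext n v
  simp [zMul]

theorem zMul_zMul_eq (k l : ℤ) (a : OpSeries F L) : zMul k (zMul l a) = zMul (k + l) a := by
  ext n v
  simp [zMul, sub_sub]

theorem zMul_smul (k : ℤ) (c : F) (a : OpSeries F L) : zMul k (c • a) = c • zMul k a := rfl

theorem idSeries_mulSeries {b : OpSeries F L} (h : QuasiCommutative (idSeries F L) b) :
    idSeries F L ⋆ b = b := by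
  ext n v
  rw [mulSeries_apply h, finsum_eq_single _ 0 fun i hi => by simp [idSeries, hi]]
  simp [idSeries]

theorem mulSeries_idSeries {a : OpSeries F L} (h : QuasiCommutative a (idSeries F L)) :
    a ⋆ idSeries F L = a := by
  ext n v
  rw [mulSeries_apply h, finsum_eq_single _ n fun i hi => by simp [idSeries, sub_eq_zero, hi.symm]]
  simp [idSeries]

theorem scale_zero (β : F) : scale β (0 : OpSeries F L) = 0 := by
  ext n v
  simp [scale]

theorem scale_one (a : OpSeries F L) : scale 1 a = a := by
  ext n v
  simp [scale]

theorem scale_scale (β γ : F) (a : OpSeries F L) : scale β (scale γ a) = scale (β * γ) a := by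
  ext n v
  simp [scale, mul_zpow, smul_smul]

theorem scale_add (β : F) (a b : OpSeries F L) : scale β (a + b) = scale β a + scale β b := by
  ext n v
  simp [scale]

theorem scale_smul (β c : F) (a : OpSeries F L) : scale β (c • a) = c • scale β a := by
  ext n v
  simp [scale, smul_smul, mul_comm]

theorem scale_idSeries (β : F) : scale β (idSeries F L) = idSeries F L := by
  ext n v
  by_cases hn : n = 0 <;> simp [scale, idSeries, hn]

theorem scale_zMul {β : F} (hβ : β ≠ 0) (k : ℤ) (a : OpSeries F L) :
    scale β (zMul k a) = β ^ k • zMul k (scale β a) := by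
  ext n v
  simp only [scale, zMul, Pi.smul_apply, LinearMap.smul_apply, smul_smul, ← zpow_add₀ hβ]
  congr 2
  ring

theorem scale_mulSeries {a b : OpSeries F L} {β : F} (hβ : β ≠ 0) (h : QuasiCommutative a b)
    (h' : QuasiCommutative (scale β a) (scale β b)) :
    scale β (a ⋆ b) = scale β a ⋆ scale β b := by
  ext n v
  rw [mulSeries_apply h', scale, LinearMap.smul_apply, mulSeries_apply h,
    smul_finsum' _ (h.finite_support n v)]
  refine finsum_congr fun i => ?_
  simp only [scale, LinearMap.smul_apply, map_smul, smul_smul, ← zpow_add₀ hβ]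
  congr 2
  ring

/-- The `q`-derivation as a linear map. -/
def qDerivₗ (q : F) : Module.End F (OpSeries F L) where
  toFun := qDeriv q
  map_add' a b := by
    ext n v
    simp only [qDeriv, scale, Pi.add_apply, LinearMap.smul_apply, LinearMap.sub_apply,
      LinearMap.add_apply, smul_add, smul_sub]
    abel
  map_smul' c a := by
    ext n v
    simp only [qDeriv, scale, Pi.smul_apply, LinearMap.smul_apply, LinearMap.sub_apply,
      smul_sub, smul_smul, RingHom.id_apply]
    congr 2 <;> ring

theorem qDerivₗ_apply (q : F) (a : OpSeries F L) : qDerivₗ q a = qDeriv q a := rfl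

theorem qDeriv_iterate (q : F) (n : ℕ) (a : OpSeries F L) :
    (qDeriv q)^[n] a = (qDerivₗ q ^ n) a := by
  rw [Module.End.pow_apply]
  rfl

theorem qDeriv_eq (q : F) (a : OpSeries F L) :
    qDeriv q a = (q - 1)⁻¹ • (zMul (-1) (scale q a) + (-1 : F) • zMul (-1) a) := by
  ext n v
  simp [qDeriv, zMul, sub_eq_add_neg]

theorem qDeriv_idSeries (q : F) : qDeriv q (idSeries F L) = 0 := by
  rw [qDeriv_eq, scale_idSeries]
  simp

theorem qDeriv_scale {q β : F} (hβ : β ≠ 0) (a : OpSeries F L) :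
    qDeriv q (scale β a) = β • scale β (qDeriv q a) := by
  ext n v
  simp only [qDeriv, scale, Pi.smul_apply, LinearMap.smul_apply, LinearMap.sub_apply, smul_sub,
    smul_smul, zpow_add_one₀ hβ]
  congr 2 <;> ring

/-- The twisted Leibniz rule `(ab)^{[1]}(z) = a^{[1]}(z) b(zq) + a(z) b^{[1]}(z)`. -/
theorem qDeriv_mulSeries {q : F} (hq : q ≠ 0) {a b : OpSeries F L} (h : QuasiCommutative a b)
    (h₁ : QuasiCommutative (scale q a) (scale q b)) (h₂ : QuasiCommutative a (scale q b)) :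
    qDeriv q (a ⋆ b) = qDeriv q a ⋆ scale q b + a ⋆ qDeriv q b := by
  have e₁ := h₁.zMul_zMul (-1) 0
  have e₂ := h₂.zMul_zMul (-1) 0
  have e₃ := h₂.zMul_zMul 0 (-1)
  have e₄ := h.zMul_zMul 0 (-1)
  have i₁ := zMul_mulSeries_zMul h₁ (-1) 0
  have i₂ := zMul_mulSeries_zMul h₂ (-1) 0
  have i₃ := zMul_mulSeries_zMul h₂ 0 (-1)
  have i₄ := zMul_mulSeries_zMul h 0 (-1)
  simp only [zMul_zero, add_zero, zero_add] at e₁ e₂ e₃ e₄ i₁ i₂ i₃ i₄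
  rw [qDeriv_eq, qDeriv_eq, qDeriv_eq, smul_mulSeries (e₁.add_left (e₂.smul_left _)),
    mulSeries_smul (e₃.add_right (e₄.smul_right _)), add_mulSeries e₁ (e₂.smul_left _),
    mulSeries_add e₃ (e₄.smul_right _), smul_mulSeries e₂, mulSeries_smul e₄, i₁, i₂, i₃, i₄,
    scale_mulSeries hq h h₁, ← smul_add]
  congr 1
  module

end Calculus

/-! ### Algebras of quasi-commutative fields are nonlocal `q`-vertex algebras -/

section Numbers

variable {F : Type*} [Field F]

/-- The element `q` is neither `0` nor a root of unity. -/
def NotRootOfUnity (q : F) : Prop := q ≠ 0 ∧ ∀ n : ℕ, 0 < n → q ^ n ≠ 1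

theorem NotRootOfUnity.ne_one {q : F} (hq : NotRootOfUnity q) : q ≠ 1 := by
  simpa using hq.2 1 one_pos

theorem NotRootOfUnity.zpow_ne_one {q : F} (hq : NotRootOfUnity q) {n : ℤ} (hn : n ≠ 0) :
    q ^ n ≠ 1 := by
  obtain ⟨m, rfl | rfl⟩ := n.eq_nat_or_neg
  · simpa using hq.2 m (by omega)
  · simpa using hq.2 m (by omega)

theorem qInt_zero (q : F) : qInt q 0 = 0 := by simp [qInt]

theorem qInt_add {q : F} (hq : NotRootOfUnity q) (m n : ℤ) :
    qInt q (m + n) = qInt q m + q ^ m * qInt q n := by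
  simp only [qInt, zpow_add₀ hq.1]
  ring

theorem qInt_ne_zero {q : F} (hq : NotRootOfUnity q) {n : ℤ} (hn : n ≠ 0) : qInt q n ≠ 0 :=
  div_ne_zero (sub_ne_zero.2 (hq.zpow_ne_one hn)) (sub_ne_zero.2 hq.ne_one)

theorem qFact_zero (q : F) : qFact q 0 = 1 := by simp [qFact]

theorem qFact_succ (q : F) (n : ℕ) : qFact q (n + 1) = qFact q n * qInt q (n + 1) := by
  simp [qFact, Finset.prod_range_succ]

theorem qFact_ne_zero {q : F} (hq : NotRootOfUnity q) (n : ℕ) : qFact q n ≠ 0 :=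
  Finset.prod_ne_zero_iff.2 fun k _ => qInt_ne_zero hq (by omega)

theorem qBinom_zero_right (q : F) (m : ℤ) : qBinom q m 0 = 1 := by simp [qBinom, qFact_zero]

theorem qBinom_succ_mul {q : F} (hq : NotRootOfUnity q) (m : ℤ) (l : ℕ) :
    qBinom q (m + 1) (l + 1) * qInt q (l + 1) = qInt q (m + 1) * qBinom q m l := by
  have h₁ := qFact_ne_zero hq l
  have h₂ : qInt q (l + 1) ≠ 0 := qInt_ne_zero hq (by omega)
  simp only [qBinom, Finset.prod_range_succ', qFact_succ]
  have : ∀ k : ℕ, m + 1 - ((k + 1 : ℕ) : ℤ) = m - k := fun k => by push_cast; ring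
  simp only [this, Nat.cast_zero, sub_zero]
  field_simp

theorem qBinom_eq_zero (q : F) {m : ℤ} {l : ℕ} (h₀ : 0 ≤ m) (h : m < l) : qBinom q m l = 0 := by
  rw [qBinom, Finset.prod_eq_zero (i := m.toNat), zero_div]
  · simp; omega
  · rw [Int.toNat_of_nonneg h₀, sub_self, qInt_zero]

end Numbers

section Algebras

variable {F : Type*} [Field F] {L : Type*} [AddCommGroup L] [Module F L]

local infixl:70 " ⋆ " => mulSeries

theorem rProd_of_nonneg (q : F) {r : ℤ} (hr : 0 ≤ r) (a b : OpSeries F L) : rProd q a r b = 0 :=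
  if_pos hr

/-- The divided power `a^{[n]} / [n]!` of the `q`-derivation. -/
def qDivDeriv (q : F) (n : ℕ) (a : OpSeries F L) : OpSeries F L :=
  (qFact q n)⁻¹ • (qDerivₗ q ^ n) a

theorem qDivDeriv_zero (q : F) (a : OpSeries F L) : qDivDeriv q 0 a = a := by
  simp [qDivDeriv, qFact_zero]

theorem qDeriv_qDivDeriv {q : F} (hq : NotRootOfUnity q) (n : ℕ) (a : OpSeries F L) :
    qDeriv q (qDivDeriv q n a) = qInt q (n + 1) • qDivDeriv q (n + 1) a := by
  have h : qInt q (n + 1) ≠ 0 := qInt_ne_zero hq (by omega)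
  have h' := qFact_ne_zero hq n
  rw [← qDerivₗ_apply, qDivDeriv, qDivDeriv, map_smul, smul_smul, qFact_succ, pow_succ',
    Module.End.mul_apply]
  congr 1
  field_simp

/-- A space of pairwise quasi-commutative fields that contains `1_L` and is an associative algebra
under the multiplication of series, stable under `a(z) ↦ a(zq)` and under the `q`-derivation. -/
structure IsFieldAlgebra (q : F) (V : Submodule F (OpSeries F L)) : Prop where
  le_fieldSpace : V ≤ fieldSpace F L
  one_mem : idSeries F L ∈ V
  quasiCommutative : ∀ a ∈ V, ∀ b ∈ V, QuasiCommutative a b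
  scale_mem : ∀ a ∈ V, scale q a ∈ V
  qDeriv_mem : ∀ a ∈ V, qDeriv q a ∈ V
  mul_mem : ∀ a ∈ V, ∀ b ∈ V, a ⋆ b ∈ V
  mul_assoc : ∀ a ∈ V, ∀ b ∈ V, ∀ c ∈ V, a ⋆ b ⋆ c = a ⋆ (b ⋆ c)

namespace IsFieldAlgebra

variable {q : F} {V : Submodule F (OpSeries F L)}

theorem scale_pow_mem (hV : IsFieldAlgebra q V) (n : ℕ) {a : OpSeries F L} (ha : a ∈ V) :
    scale (q ^ n) a ∈ V := by
  induction n with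
  | zero => simpa [scale_one] using ha
  | succ n ih => rw [pow_succ', ← scale_scale]; exact hV.scale_mem _ ih

theorem qDivDeriv_mem (hV : IsFieldAlgebra q V) (n : ℕ) {a : OpSeries F L} (ha : a ∈ V) :
    qDivDeriv q n a ∈ V := by
  refine V.smul_mem _ ?_
  induction n with
  | zero => exact ha
  | succ n ih => rw [pow_succ', Module.End.mul_apply]; exact hV.qDeriv_mem _ ih

theorem rProd_eq (hV : IsFieldAlgebra q V) {a b : OpSeries F L} (ha : a ∈ V) (hb : b ∈ V)
    {r : ℤ} {n : ℕ} (hr : r = -n - 1) :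
    rProd q a r b = qDivDeriv q n a ⋆ scale (q ^ n) b := by
  have hn : (-r - 1).toNat = n := by omega
  have hn' : -r - 1 = n := by omega
  have h : (qDerivₗ q ^ n) a ∈ V := by
    induction n generalizing r with
    | zero => exact ha
    | succ n ih =>
      rw [pow_succ', Module.End.mul_apply]
      exact hV.qDeriv_mem _ (ih (r := -n - 1) rfl (by omega) (by omega))
  rw [rProd, if_neg (by omega), hn, hn', qDeriv_iterate, qDivDeriv, zpow_natCast,
    smul_mulSeries (hV.quasiCommutative _ h _ (hV.scale_pow_mem n hb))]

theorem rProd_mem (hV : IsFieldAlgebra q V) {a b : OpSeries F L} (ha : a ∈ V) (hb : b ∈ V)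
    (r : ℤ) : rProd q a r b ∈ V := by
  rcases lt_or_ge r 0 with hr | hr
  · rw [hV.rProd_eq ha hb (n := (-r - 1).toNat) (by omega)]
    exact hV.mul_mem _ (hV.qDivDeriv_mem _ ha) _ (hV.scale_pow_mem _ hb)
  · rw [rProd_of_nonneg q hr]
    exact V.zero_mem

/-- The `q`-derivation of the products `P_{k,n} = (a^{[k]}/[k]!)(z) (b^{[n]}/[n]!)(z q^k)`. -/
theorem qDeriv_divided_mul (hV : IsFieldAlgebra q V) (hq : NotRootOfUnity q)
    {a b : OpSeries F L} (ha : a ∈ V) (hb : b ∈ V) (k n : ℕ) :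
    qDeriv q (qDivDeriv q k a ⋆ scale (q ^ k) (qDivDeriv q n b)) =
      qInt q (k + 1) • (qDivDeriv q (k + 1) a ⋆ scale (q ^ (k + 1)) (qDivDeriv q n b)) +
      (q ^ k * qInt q (n + 1)) • (qDivDeriv q k a ⋆ scale (q ^ k) (qDivDeriv q (n + 1) b)) := by
  have hA := fun k => hV.qDivDeriv_mem k ha
  have hB := fun k n => hV.scale_pow_mem k (hV.qDivDeriv_mem n hb)
  rw [qDeriv_mulSeries hq.1 (hV.quasiCommutative _ (hA k) _ (hB k n))
    (hV.quasiCommutative _ (hV.scale_mem _ (hA k)) _ (hV.scale_mem _ (hB k n)))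
    (hV.quasiCommutative _ (hA k) _ (hV.scale_mem _ (hB k n))),
    qDeriv_qDivDeriv hq, qDeriv_scale (pow_ne_zero _ hq.1), qDeriv_qDivDeriv hq, scale_smul,
    smul_smul, scale_scale, ← pow_succ',
    smul_mulSeries (hV.quasiCommutative _ (hA _) _ (hB _ _)),
    mulSeries_smul (hV.quasiCommutative _ (hA _) _ (hB _ _))]

/-- The `q`-analogue of the Leibniz rule for higher derivatives; it is the associativity axiom with
the last argument removed. -/
theorem qDivDeriv_mul (hV : IsFieldAlgebra q V) (hq : NotRootOfUnity q)
    {a b : OpSeries F L} (ha : a ∈ V) (hb : b ∈ V) (i j : ℕ) :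
    qDivDeriv q j (qDivDeriv q i a ⋆ scale (q ^ i) b) =
      ∑ l ∈ Finset.range (j + 1), (q ^ ((j - l) * i) * qBinom q (i + l) l) •
        (qDivDeriv q (i + l) a ⋆ scale (q ^ (i + l)) (qDivDeriv q (j - l) b)) := by
  induction j with
  | zero => simp [qDivDeriv_zero, qBinom_zero_right]
  | succ j ih =>
    have hj : qInt q (j + 1) ≠ 0 := qInt_ne_zero hq (by omega)
    have key := qDeriv_qDivDeriv hq j (qDivDeriv q i a ⋆ scale (q ^ i) b)
    set T : ℕ → ℕ → OpSeries F L := fun k n =>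
      qDivDeriv q k a ⋆ scale (q ^ k) (qDivDeriv q n b) with hT
    have hD : ∀ k n, qDerivₗ q (T k n) = qInt q (k + 1) • T (k + 1) n +
        (q ^ k * qInt q (n + 1)) • T k (n + 1) := hV.qDeriv_divided_mul hq ha hb
    change _ = ∑ l ∈ Finset.range (j + 1 + 1), (q ^ ((j + 1 - l) * i) * qBinom q (i + l) l) •
      T (i + l) (j + 1 - l)
    change _ = ∑ l ∈ Finset.range (j + 1), (q ^ ((j - l) * i) * qBinom q (i + l) l) •
      T (i + l) (j - l) at ih
    rw [ih, ← qDerivₗ_apply, map_sum] at key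
    refine smul_right_injective _ hj (key.symm.trans ?_)
    have split : ∀ l ∈ Finset.range (j + 1 + 1),
        qInt q (j + 1) • (q ^ ((j + 1 - l) * i) * qBinom q (i + l) l) • T (i + l) (j + 1 - l) =
        (q ^ ((j + 1 - l) * i) * (qBinom q (i + l) l * qInt q l)) • T (i + l) (j + 1 - l) +
        (q ^ l * qInt q ((j + 1 - l : ℕ) : ℤ) * q ^ ((j + 1 - l) * i) * qBinom q (i + l) l) •
          T (i + l) (j + 1 - l) := by
      intro l hl
      have : (j : ℤ) + 1 = (l : ℤ) + ((j + 1 - l : ℕ) : ℤ) := by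
        have := Finset.mem_range.1 hl
        omega
      rw [this, qInt_add hq, smul_smul, ← add_smul, zpow_natCast]
      congr 1
      ring
    simp only [Finset.smul_sum]
    rw [Finset.sum_congr rfl split, Finset.sum_add_distrib, Finset.sum_range_succ' _ (j + 1),
      Finset.sum_range_succ (fun l => (q ^ l * qInt q ((j + 1 - l : ℕ) : ℤ) *
        q ^ ((j + 1 - l) * i) * qBinom q (i + l) l) • T (i + l) (j + 1 - l)) (j + 1)]
    simp only [Nat.sub_self, Nat.cast_zero, qInt_zero, mul_zero, zero_mul, zero_smul, add_zero]
    rw [← Finset.sum_add_distrib]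
    refine Finset.sum_congr rfl fun l hl => ?_
    have hl' := Finset.mem_range.1 hl
    rw [map_smul, hD, smul_add, smul_smul, smul_smul]
    have e₁ := qBinom_succ_mul hq (i + l) l
    have e₂ : j + 1 - (l + 1) = j - l := by omega
    have e₃ : j + 1 - l = j - l + 1 := by omega
    have e₄ : ((l + 1 : ℕ) : ℤ) = l + 1 := by push_cast; ring
    rw [e₂, e₃, e₄, ← add_assoc (i : ℤ), e₁, ← add_assoc i l 1]
    push_cast
    congr 2
    · ring
    · ring

/-- Associativity for the nonnegative exponents `i`, `j`. -/
theorem sum_rProd_rProd (hV : IsFieldAlgebra q V) (hq : NotRootOfUnity q)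
    {a b c : OpSeries F L} (ha : a ∈ V) (hb : b ∈ V) (hc : c ∈ V) (i j : ℕ) :
    ∑ l ∈ Finset.range (j + 1), (q ^ ((j - l) * i) * qBinom q (i + l) l) •
        rProd q a (-((i + l : ℕ) : ℤ) - 1) (rProd q b (-((j - l : ℕ) : ℤ) - 1) c) =
      rProd q (rProd q a (-i - 1) b) (-j - 1) (scale (q ^ i) c) := by
  have hqc := hV.quasiCommutative
  have hA := fun k => hV.qDivDeriv_mem k ha
  have hab := hV.mul_mem _ (hA i) _ (hV.scale_pow_mem i hb)
  have hs := fun k => hV.scale_pow_mem k hc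
  have hprod := fun k n => hV.mul_mem _ (hA k) _ (hV.scale_pow_mem k (hV.qDivDeriv_mem n hb))
  have hsum : ∀ t : Finset ℕ, ∀ f : ℕ → F, ∀ g : ℕ → OpSeries F L, (∀ l, g l ∈ V) →
      ∀ d ∈ V, (∑ l ∈ t, f l • g l) ⋆ d = ∑ l ∈ t, f l • (g l ⋆ d) := by
    intro t f g hg d hd
    induction t using Finset.cons_induction with
    | empty => simp [zero_mulSeries]
    | cons x t hx ih =>
      rw [Finset.sum_cons, Finset.sum_cons, add_mulSeries
        (hqc _ (V.smul_mem _ (hg x)) _ hd)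
        (hqc _ (V.sum_mem fun l _ => V.smul_mem _ (hg l)) _ hd), ih,
        smul_mulSeries (hqc _ (hg x) _ hd)]
  rw [hV.rProd_eq ha hb (n := i) rfl, hV.rProd_eq hab (hs i) (n := j) rfl,
    hV.qDivDeriv_mul hq ha hb i j, scale_scale, ← pow_add,
    hsum _ _ _ (fun l => hprod _ _) _ (hs (j + i))]
  refine Finset.sum_congr rfl fun l hl => ?_
  have hl' := Finset.mem_range.1 hl
  have hbc := hV.mul_mem _ (hV.qDivDeriv_mem (j - l) hb) _ (hs (j - l))
  rw [hV.rProd_eq hb hc (n := j - l) rfl, hV.rProd_eq ha hbc (n := i + l) rfl,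
    scale_mulSeries (pow_ne_zero _ hq.1)
      (hqc _ (hV.qDivDeriv_mem (j - l) hb) _ (hs (j - l)))
      (hqc _ (hV.scale_pow_mem _ (hV.qDivDeriv_mem (j - l) hb)) _
        (hV.scale_pow_mem _ (hs (j - l)))), scale_scale, ← pow_add,
    hV.mul_assoc _ (hA _) _ (hV.scale_pow_mem _ (hV.qDivDeriv_mem (j - l) hb)) _ (hs _),
    show i + l + (j - l) = j + i by omega]

theorem rProd_zero_right (hV : IsFieldAlgebra q V) {a : OpSeries F L} (ha : a ∈ V) (r : ℤ) :
    rProd q a r (0 : OpSeries F L) = 0 := by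
  rcases lt_or_ge r 0 with hr | hr
  · rw [hV.rProd_eq ha V.zero_mem (n := (-r - 1).toNat) (by omega), scale_zero, mulSeries_zero]
  · exact rProd_of_nonneg q hr _ _

/-- The `q`-Leibniz rule gives the associativity of the products `a(z)_r b(z)`. -/
theorem isQVertexAlgebraOfFields (hV : IsFieldAlgebra q V) (hq : NotRootOfUnity q) :
    IsQVertexAlgebraOfFields q V := by
  have hqc := hV.quasiCommutative
  refine ⟨hqc, hV.le_fieldSpace, hV.one_mem, fun a ha b hb r => hV.rProd_mem ha hb r, ?_, ?_,
    fun a _ b _ => ⟨0, fun r hr => rProd_of_nonneg q hr a b⟩, ?_, ?_, ?_⟩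
  · intro a ha a' ha' b hb k r
    rcases lt_or_ge r 0 with hr | hr
    · have hr : r = -((-r - 1).toNat : ℤ) - 1 := by omega
      have hA := fun a ha => hqc _ (hV.qDivDeriv_mem (-r - 1).toNat (a := a) ha) _
        (hV.scale_pow_mem (-r - 1).toNat hb)
      rw [hV.rProd_eq ha hb hr, hV.rProd_eq ha' hb hr,
        hV.rProd_eq (V.add_mem (V.smul_mem k ha) ha') hb hr, ← smul_mulSeries (hA a ha),
        ← add_mulSeries ((hA a ha).smul_left k) (hA a' ha')]
      congr 1
      simp only [qDivDeriv, map_add, map_smul, smul_add, smul_smul, mul_comm]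
    · simp [rProd_of_nonneg q hr]
  · intro a ha b hb b' hb' k r
    rcases lt_or_ge r 0 with hr | hr
    · have hr : r = -((-r - 1).toNat : ℤ) - 1 := by omega
      have hB := fun b hb => hqc _ (hV.qDivDeriv_mem (-r - 1).toNat ha) _
        (hV.scale_pow_mem (-r - 1).toNat (a := b) hb)
      rw [hV.rProd_eq ha hb hr, hV.rProd_eq ha hb' hr,
        hV.rProd_eq ha (V.add_mem (V.smul_mem k hb) hb') hr, ← mulSeries_smul (hB b hb),
        ← mulSeries_add ((hB b hb).smul_right k) (hB b' hb'), scale_add, scale_smul]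
    · simp [rProd_of_nonneg q hr]
  · intro b hb r
    rcases lt_or_ge r 0 with hr | hr
    · have hr' : r = -((-r - 1).toNat : ℤ) - 1 := by omega
      rw [hV.rProd_eq hV.one_mem hb hr']
      rcases eq_or_ne r (-1) with rfl | h1
      · simp [qDivDeriv_zero, scale_one, idSeries_mulSeries (hqc _ hV.one_mem _ hb)]
      · obtain ⟨n, hn⟩ : ∃ n, (-r - 1).toNat = n + 1 := ⟨(-r - 2).toNat, by omega⟩
        rw [if_neg h1, hn, qDivDeriv, pow_succ, Module.End.mul_apply, qDerivₗ_apply,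
          qDeriv_idSeries, map_zero, smul_zero, zero_mulSeries]
    · rw [rProd_of_nonneg q hr, if_neg (by omega)]
  · intro a ha
    refine ⟨fun r hr => rProd_of_nonneg q hr a _, ?_⟩
    rw [hV.rProd_eq ha hV.one_mem (n := 0) (by norm_num), scale_idSeries, qDivDeriv_zero,
      mulSeries_idSeries (hqc _ ha _ hV.one_mem)]
  · intro a ha b hb c hc i j
    rcases lt_or_ge j 0 with hj | hj
    · rw [rProd_of_nonneg q (by omega : 0 ≤ -j - 1)]
      refine finsum_eq_zero_of_forall_eq_zero fun l => ?_
      rw [rProd_of_nonneg q (by omega : 0 ≤ -(j - l) - 1), hV.rProd_zero_right ha, smul_zero]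
    rcases lt_or_ge i 0 with hi | hi
    · have h₀ : rProd q (0 : OpSeries F L) (-j - 1) (scale (q ^ i) c) = 0 := by
        rw [rProd, if_neg (by omega), qDeriv_iterate, map_zero, zero_mulSeries, smul_zero]
      rw [rProd_of_nonneg q (by omega : 0 ≤ -i - 1), h₀]
      refine finsum_eq_zero_of_forall_eq_zero fun l => ?_
      rcases lt_or_ge (i + l) 0 with hl | hl
      · rw [rProd_of_nonneg q (by omega : 0 ≤ -(i + l) - 1), smul_zero]
      · rw [qBinom_eq_zero q hl (by omega), mul_zero, zero_smul]
    · lift i to ℕ using hi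
      lift j to ℕ using hj
      rw [finsum_eq_sum_of_support_subset (s := Finset.range (j + 1)), zpow_natCast,
        ← hV.sum_rProd_rProd hq ha hb hc i j]
      · refine Finset.sum_congr rfl fun l hl => ?_
        have hl' := Nat.lt_succ_iff.1 (Finset.mem_range.1 hl)
        rw [← zpow_natCast]
        push_cast [Nat.cast_sub hl']
        rfl
      · intro l hl
        by_contra hl'
        refine hl ?_
        have hlj : (j : ℤ) < l := by
          have : ¬ l < j + 1 := fun h => hl' (by simpa using h)
          omega
        dsimp only
        rw [rProd_of_nonneg q (by omega : 0 ≤ -(j - l : ℤ) - 1), hV.rProd_zero_right ha,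
          smul_zero]

end IsFieldAlgebra

end Algebras

/-! ### Exponentials of power series over a noncommutative algebra -/

section Exponentials

open PowerSeries

variable {A : Type*} [Ring A]

/-- The Euler operator `w d/dw` on power series. -/
def euler (f : PowerSeries A) : PowerSeries A := PowerSeries.mk fun n => n • coeff n f

@[simp]
theorem coeff_euler (n : ℕ) (f : PowerSeries A) : coeff n (euler f) = n • coeff n f :=
  coeff_mk _ _

theorem euler_add (f g : PowerSeries A) : euler (f + g) = euler f + euler g := by
  ext n
  simp [smul_add]

theorem euler_mul (f g : PowerSeries A) : euler (f * g) = euler f * g + f * euler g := by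
  ext n
  simp only [coeff_euler, map_add, coeff_mul, Finset.smul_sum, ← Finset.sum_add_distrib]
  refine Finset.sum_congr rfl fun p hp => ?_
  rw [← Finset.HasAntidiagonal.mem_antidiagonal.1 hp, add_smul, smul_mul_assoc, mul_smul_comm]

theorem euler_C (a : A) : euler (C a) = 0 := by
  ext n
  rcases eq_or_ne n 0 with rfl | hn
  · simp
  · simp [coeff_C, hn]

theorem euler_pow {f : PowerSeries A} (h : Commute (euler f) f) (n : ℕ) :
    euler (f ^ (n + 1)) = (n + 1) • (euler f * f ^ n) := by
  induction n with
  | zero => simp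
  | succ n ih =>
    rw [pow_succ' f (n + 1), euler_mul, ih, mul_smul_comm, ← mul_assoc f, ← h.eq, mul_assoc,
      ← pow_succ', succ_nsmul' _ (n + 1)]

/-- All coefficients of `f` commute with all coefficients of `g`. -/
def CoeffCommute (f g : PowerSeries A) : Prop := ∀ i j, Commute (coeff i f) (coeff j g)

theorem CoeffCommute.commute {f g : PowerSeries A} (h : CoeffCommute f g) : Commute f g := by
  ext n
  rw [coeff_mul, coeff_mul, ← Finset.Nat.sum_antidiagonal_swap]
  exact Finset.sum_congr rfl fun p _ => (h _ _).eq

theorem CoeffCommute.euler_left {f g : PowerSeries A} (h : CoeffCommute f g) :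
    CoeffCommute (euler f) g := fun i j => by
  rw [coeff_euler]
  exact (h i j).smul_left i

theorem coeff_pow_eq_zero {f : PowerSeries A} (h₀ : coeff 0 f = 0) {n k : ℕ} (hk : k < n) :
    coeff k (f ^ n) = 0 := by
  induction n generalizing k with
  | zero => omega
  | succ n ih =>
    rw [pow_succ', coeff_mul]
    refine Finset.sum_eq_zero fun p hp => ?_
    have := Finset.HasAntidiagonal.mem_antidiagonal.1 hp
    rcases Nat.eq_zero_or_pos p.1 with h | h
    · rw [h, h₀, zero_mul]
    · rw [ih (by omega), mul_zero]

theorem nsmul_left_cancel (K : Type*) [Field K] [CharZero K] [Algebra K A]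
    {n : ℕ} (hn : n ≠ 0) {x y : A} (h : n • x = n • y) : x = y := by
  rw [← Nat.cast_smul_eq_nsmul K, ← Nat.cast_smul_eq_nsmul K] at h
  exact smul_right_injective A (Nat.cast_ne_zero.2 hn) h

/-- The differential equation `w Y' = F Y` with `F(0) = 0` determines `Y` from `Y(0)`. -/
theorem eq_of_euler_eq (K : Type*) [Field K] [CharZero K] [Algebra K A]
    {F Y Z : PowerSeries A} (hF : coeff 0 F = 0) (hY : euler Y = F * Y)
    (hZ : euler Z = F * Z)
    (h₀ : coeff 0 Y = coeff 0 Z) : Y = Z := by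
  ext n
  induction n using Nat.strong_induction_on with
  | _ n ih =>
    rcases eq_or_ne n 0 with rfl | hn
    · exact h₀
    · refine nsmul_left_cancel K hn ?_
      rw [← coeff_euler, ← coeff_euler, hY, hZ, coeff_mul, coeff_mul]
      refine Finset.sum_congr rfl fun p hp => ?_
      have := Finset.HasAntidiagonal.mem_antidiagonal.1 hp
      rcases Nat.eq_zero_or_pos p.1 with h | h
      · rw [h, hF, zero_mul, zero_mul]
      · rw [ih _ (by omega)]

variable (K : Type*) [Field K] [Algebra K A]

/-- The exponential `∑ₙ fⁿ / n!` of a power series without constant term. -/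
def expSeries (f : PowerSeries A) : PowerSeries A :=
  PowerSeries.mk fun k => ∑ n ∈ Finset.range (k + 1), ((n.factorial : K)⁻¹) • coeff k (f ^ n)

theorem coeff_expSeries {f : PowerSeries A} (h₀ : coeff 0 f = 0) {k N : ℕ} (hN : k < N) :
    coeff k (expSeries K f) =
      ∑ n ∈ Finset.range N, ((n.factorial : K)⁻¹) • coeff k (f ^ n) := by
  rw [expSeries, coeff_mk]
  refine Finset.sum_subset (by simpa using hN) fun n _ hn => ?_
  rw [coeff_pow_eq_zero h₀ (by simpa using hn), smul_zero]

theorem coeff_zero_expSeries (f : PowerSeries A) : coeff 0 (expSeries K f) = 1 := by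
  simp [expSeries]

theorem expSeries_zero : expSeries K (0 : PowerSeries A) = 1 := by
  ext k
  rw [expSeries, coeff_mk, Finset.sum_range_succ', Finset.sum_eq_zero fun n _ => by simp]
  simp

theorem map_expSeries {B : Type*} [Ring B] [Algebra K B] (φ : A →ₐ[K] B) (f : PowerSeries A) :
    PowerSeries.map (φ : A →+* B) (expSeries K f) =
      expSeries K (PowerSeries.map (φ : A →+* B) f) := by
  ext k
  simp only [coeff_map, expSeries, coeff_mk, map_sum, ← map_pow]
  exact Finset.sum_congr rfl fun n _ => map_smul φ _ _

theorem commute_coeff_expSeries {f : PowerSeries A} {x : A} (h : ∀ i, Commute x (coeff i f))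
    (j : ℕ) : Commute x (coeff j (expSeries K f)) := by
  have hC : Commute (C x) f := by
    ext n
    simpa using (h n).eq
  rw [expSeries, coeff_mk]
  refine Commute.sum_right _ _ _ fun n _ => Commute.smul_right ?_ _
  have := congrArg (coeff j) (hC.pow_right n).eq
  rwa [coeff_C_mul, coeff_mul_C] at this

/-- Conjugation by an element commutes with exponentials. -/
theorem semiconjBy_expSeries {f g : PowerSeries A} {x : A} (h : SemiconjBy (C x) f g) :
    SemiconjBy (C x) (expSeries K f) (expSeries K g) := by
  ext k
  have hk : ∀ n, x * coeff k (f ^ n) = coeff k (g ^ n) * x := fun n => by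
    simpa using congrArg (coeff k) (h.pow_right n).eq
  simp only [coeff_C_mul, coeff_mul_C, expSeries, coeff_mk, Finset.mul_sum, Finset.sum_mul,
    mul_smul_comm, smul_mul_assoc, hk]

variable [CharZero K]

theorem euler_expSeries {f : PowerSeries A} (h₀ : coeff 0 f = 0) (h : CoeffCommute f f) :
    euler (expSeries K f) = euler f * expSeries K f := by
  ext k
  have hsum : coeff k (euler f * expSeries K f) =
      ∑ n ∈ Finset.range (k + 1), ((n.factorial : K)⁻¹) • coeff k (euler f * f ^ n) := by
    simp only [coeff_mul, Finset.smul_sum]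
    rw [Finset.sum_comm]
    refine Finset.sum_congr rfl fun p hp => ?_
    have := Finset.HasAntidiagonal.mem_antidiagonal.1 hp
    rw [coeff_expSeries K h₀ (N := k + 1) (by omega), Finset.mul_sum]
    exact Finset.sum_congr rfl fun n _ => mul_smul_comm _ _ _
  have hlast : coeff k (euler f * f ^ k) = 0 := by
    rw [coeff_mul]
    refine Finset.sum_eq_zero fun p hp => ?_
    have := Finset.HasAntidiagonal.mem_antidiagonal.1 hp
    rcases Nat.eq_zero_or_pos p.1 with h | h
    · rw [h, coeff_euler, zero_smul, zero_mul]
    · rw [coeff_pow_eq_zero h₀ (by omega), mul_zero]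
  rw [hsum, Finset.sum_range_succ, hlast, smul_zero, add_zero, coeff_euler, expSeries, coeff_mk,
    Finset.smul_sum, Finset.sum_range_succ']
  have hz : k • ((Nat.factorial 0 : K)⁻¹ • coeff k (f ^ 0)) = 0 := by
    rcases eq_or_ne k 0 with rfl | hk
    · simp
    · simp [coeff_one, hk]
  rw [hz, add_zero]
  refine Finset.sum_congr rfl fun n _ => ?_
  rw [smul_comm, ← coeff_euler, euler_pow h.euler_left.commute, map_nsmul,
    ← Nat.cast_smul_eq_nsmul K, smul_smul, Nat.factorial_succ]
  congr 1
  have : ((n + 1 : ℕ) : K) ≠ 0 := Nat.cast_ne_zero.2 (by omega)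
  have := Nat.cast_ne_zero (R := K).2 n.factorial_ne_zero
  push_cast at *
  field_simp

theorem expSeries_add {f g : PowerSeries A} (hf₀ : coeff 0 f = 0) (hg₀ : coeff 0 g = 0)
    (hf : CoeffCommute f f) (hg : CoeffCommute g g) (hfg : CoeffCommute f g) :
    expSeries K (f + g) = expSeries K f * expSeries K g := by
  have hgf : CoeffCommute g f := fun i j => (hfg j i).symm
  have hc : Commute (expSeries K f) (euler g) :=
    CoeffCommute.commute fun i j =>
      (commute_coeff_expSeries K (fun l => hgf.euler_left j l) i).symm
  refine eq_of_euler_eq K (F := euler (f + g)) (by simp)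
    (euler_expSeries K (by rw [map_add, hf₀, hg₀, add_zero]) fun i j => ?_) ?_ ?_
  · simp only [map_add]
    exact ((hf i j).add_right (hfg i j)).add_left ((hgf i j).add_right (hg i j))
  · rw [euler_mul, euler_expSeries K hf₀ hf, euler_expSeries K hg₀ hg, euler_add, add_mul,
      ← mul_assoc, hc.eq, mul_assoc, mul_assoc]
  · rw [coeff_zero_expSeries, coeff_mul]
    simp [coeff_zero_expSeries, -coeff_zero_eq_constantCoeff]

/-- If `[f, x] = t` is central, then `e^f x = (x + t) e^f`. -/
theorem expSeries_mul_C {f t : PowerSeries A} {x : A} (h₀ : coeff 0 f = 0) (h : CoeffCommute f f)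
    (ht₀ : coeff 0 t = 0) (ht : ∀ i a, Commute (coeff i t) a) (hx : f * C x = C x * f + t) :
    expSeries K f * C x = (C x + t) * expSeries K f := by
  have htc : ∀ g, Commute g t := fun g => CoeffCommute.commute fun i j => (ht j _).symm
  have hx' : euler f * C x = C x * euler f + euler t := by
    have := congrArg euler hx
    rwa [euler_mul, euler_add, euler_mul, euler_C, mul_zero, zero_mul, add_zero, zero_add] at this
  refine eq_of_euler_eq K (F := euler f) (by simp) ?_ ?_ ?_
  · rw [euler_mul, euler_C, mul_zero, add_zero, euler_expSeries K h₀ h, mul_assoc]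
  · rw [euler_mul, euler_expSeries K h₀ h, euler_add, euler_C, zero_add, ← mul_assoc, ← mul_assoc,
      mul_add (euler f), hx', (htc (euler f)).eq]
    noncomm_ring
  · rw [coeff_mul_C, coeff_mul]
    simp [coeff_zero_expSeries, ht₀, -coeff_zero_eq_constantCoeff]

/-- `exp (-∑_{r ≥ 1} β^r w^r / r) = 1 - β w`, in its multiplicative form for several `β`. -/
theorem expSeries_neg_log (m : Multiset K) :
    expSeries K (PowerSeries.mk fun r : ℕ => -((m.map fun β => β ^ r).sum / (r : K))) =
      (m.map fun β => 1 - C β * X).prod := by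
  have hcomm : ∀ f g : PowerSeries K, CoeffCommute f g := fun f g i j => Commute.all _ _
  induction m using Multiset.induction with
  | empty =>
    have : (PowerSeries.mk fun r : ℕ => -(((0 : Multiset K).map fun β => β ^ r).sum / (r : K)))
        = 0 := by ext n; simp
    rw [this, expSeries_zero]
    simp
  | cons β m ih =>
    have hsplit : (PowerSeries.mk fun r : ℕ => -(((β ::ₘ m).map fun β => β ^ r).sum / (r : K))) =
        (PowerSeries.mk fun r : ℕ => -(β ^ r / (r : K))) +
        PowerSeries.mk fun r : ℕ => -((m.map fun β => β ^ r).sum / (r : K)) := by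
      ext n
      simp only [coeff_mk, map_add, Multiset.map_cons, Multiset.sum_cons]
      ring
    rw [hsplit, expSeries_add K (by simp) (by simp) (hcomm _ _) (hcomm _ _) (hcomm _ _), ih,
      Multiset.map_cons, Multiset.prod_cons]
    congr 1
    refine eq_of_euler_eq K (F := euler (PowerSeries.mk fun r : ℕ => -(β ^ r / (r : K)))) (by simp)
      (euler_expSeries K (by simp) (hcomm _ _)) ?_ ?_
    · ext n
      rcases n with - | n
      · rw [coeff_mul]
        simp [-coeff_zero_eq_constantCoeff]
      · rw [mul_sub, mul_one, ← mul_assoc, map_sub, coeff_succ_mul_X, coeff_mul_C]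
        rcases n with - | n
        · simp [coeff_one]
        · have h1 : ((n : K) + 1) ≠ 0 := by exact_mod_cast n.succ_ne_zero
          have h2 : ((n : K) + 1 + 1) ≠ 0 := by exact_mod_cast (n + 1).succ_ne_zero
          simp [coeff_one]
          field_simp
          ring
    · rw [coeff_zero_expSeries]
      simp

end Exponentials

/-! ### The Heisenberg algebra and its exponentials -/

section Heisenberg

open PowerSeries

theorem notRootOfUnity_pow {K : Type*} [Field K] {x : K} (hx : NotRootOfUnity x) {n : ℕ}
    (hn : 0 < n) : NotRootOfUnity (x ^ n) :=
  ⟨pow_ne_zero _ hx.1, fun m hm => by rw [← pow_mul]; exact hx.2 _ (Nat.mul_pos hn hm)⟩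

theorem notRootOfUnity_sqrtq : NotRootOfUnity sqrtq := by
  refine ⟨RatFunc.X_ne_zero, fun n hn h => ?_⟩
  have h' : algebraMap (Polynomial ℂ) (RatFunc ℂ) (Polynomial.X ^ n) =
      algebraMap (Polynomial ℂ) (RatFunc ℂ) 1 := by
    rw [map_pow, RatFunc.algebraMap_X, map_one]
    exact h
  have := congrArg Polynomial.natDegree (RatFunc.algebraMap_injective ℂ h')
  simp at this
  omega

theorem notRootOfUnity_q₀ : NotRootOfUnity q₀ := notRootOfUnity_pow notRootOfUnity_sqrtq two_pos

theorem notRootOfUnity_qq : NotRootOfUnity qq := notRootOfUnity_pow notRootOfUnity_q₀ two_pos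

/-- The coefficient `q^{-r/2} / [r]` in the Frenkel-Jing operator. -/
def fjCoeff (r : ℕ) : Scalars := sqrtq ^ (-(r : ℤ)) / qIntSymm q₀ r

/-- The scalar `[a(r), a(-r)] = [2r] [r] / r`. -/
def heisenberg (r : ℕ+) : Scalars := qIntSymm q₀ (2 * r) * qIntSymm q₀ r / (r : ℕ)

theorem qIntSymm_ne_zero {r : ℕ} (hr : 0 < r) : qIntSymm q₀ r ≠ 0 := by
  have h0 := notRootOfUnity_q₀.1
  have key : ∀ n : ℕ, 0 < n → q₀ ^ (n : ℤ) - q₀ ^ (-(n : ℤ)) ≠ 0 := fun n hn h => by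
    refine notRootOfUnity_q₀.zpow_ne_one (n := 2 * n) (by omega) ?_
    rw [two_mul, zpow_add₀ h0]
    nth_rw 2 [sub_eq_zero.1 h]
    rw [← zpow_add₀ h0, add_neg_cancel, zpow_zero]
  refine div_ne_zero (key r hr) ?_
  simpa using key 1 one_pos

/-- The commutator of the terms of degree `r` in the two exponents of the Frenkel-Jing operator. -/
theorem fjCoeff_sq_mul_heisenberg (r : ℕ+) :
    fjCoeff r * fjCoeff r * heisenberg r = (1 + qq ^ (-(r : ℤ))) / (r : ℕ) := by
  have h0 := notRootOfUnity_q₀.1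
  have hs := notRootOfUnity_sqrtq.1
  have h1 := qIntSymm_ne_zero r.pos
  have h2 : qIntSymm q₀ (2 * r) =
      qIntSymm q₀ r * (q₀ ^ ((r : ℕ) : ℤ) + q₀ ^ (-((r : ℕ) : ℤ))) := by
    simp only [qIntSymm, two_mul, neg_add, zpow_add₀ h0]
    ring
  have h3 : sqrtq ^ (-((r : ℕ) : ℤ)) * sqrtq ^ (-((r : ℕ) : ℤ)) = q₀ ^ (-((r : ℕ) : ℤ)) := by
    rw [← mul_zpow, q₀, sq]
  have h4 : q₀ ^ (-((r : ℕ) : ℤ)) * q₀ ^ (-((r : ℕ) : ℤ)) = qq ^ (-((r : ℕ) : ℤ)) := by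
    rw [← mul_zpow, qq, sq]
  have h5 : q₀ ^ (-((r : ℕ) : ℤ)) * q₀ ^ ((r : ℕ) : ℤ) = 1 := by
    rw [← zpow_add₀ h0, neg_add_cancel, zpow_zero]
  rw [heisenberg, h2, fjCoeff]
  field_simp
  rw [sq, h3, mul_add, h4, h5]

/-- The exponent `∑_{r ≥ 1} (q^{-r/2} / [r]) p(r) a(-r) w^r`. -/
def minusExponent (p : ℕ → Scalars) : PowerSeries (Module.End Scalars Fock) :=
  PowerSeries.mk fun r : ℕ =>
    if h : 0 < r then (sqrtq ^ (-(r : ℤ)) / qIntSymm q₀ r * p r) • creator ⟨r, h⟩ else 0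

/-- The exponent `-∑_{r ≥ 1} (q^{-r/2} / [r]) p(r) a(r) w^r`. -/
def plusExponent (p : ℕ → Scalars) : PowerSeries (Module.End Scalars Fock) :=
  PowerSeries.mk fun r : ℕ =>
    if h : 0 < r then -(sqrtq ^ (-(r : ℤ)) / qIntSymm q₀ r * p r) • annihilator ⟨r, h⟩ else 0

theorem coeff_minusExponent (p : ℕ → Scalars) (r : ℕ+) :
    coeff r (minusExponent p) = (fjCoeff r * p r) • creator r := by
  rw [minusExponent, coeff_mk, dif_pos r.pos]
  rfl

theorem coeff_plusExponent (p : ℕ → Scalars) (r : ℕ+) :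
    coeff r (plusExponent p) = -(fjCoeff r * p r) • annihilator r := by
  rw [plusExponent, coeff_mk, dif_pos r.pos]
  rfl

theorem coeff_zero_minusExponent (p : ℕ → Scalars) : coeff 0 (minusExponent p) = 0 := by
  rw [minusExponent, coeff_mk, dif_neg (lt_irrefl 0)]

theorem coeff_zero_plusExponent (p : ℕ → Scalars) : coeff 0 (plusExponent p) = 0 := by
  rw [plusExponent, coeff_mk, dif_neg (lt_irrefl 0)]

theorem minusExponent_add (p p' : ℕ → Scalars) :
    minusExponent (p + p') = minusExponent p + minusExponent p' := by
  ext1 n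
  simp only [minusExponent, coeff_mk, map_add]
  split_ifs
  · rw [← add_smul, Pi.add_apply, mul_add]
  · rw [add_zero]

theorem plusExponent_add (p p' : ℕ → Scalars) :
    plusExponent (p + p') = plusExponent p + plusExponent p' := by
  ext1 n
  simp only [plusExponent, coeff_mk, map_add]
  split_ifs
  · rw [← add_smul, Pi.add_apply, mul_add, neg_add]
  · rw [add_zero]

theorem creator_apply (r : ℕ+) (f : Fock) : creator r f = MvPolynomial.X r * f := rfl

theorem annihilator_apply (r : ℕ+) (f : Fock) :
    annihilator r f = heisenberg r • MvPolynomial.pderiv r f := rfl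

theorem commute_creator (r s : ℕ+) : Commute (creator r) (creator s) := by
  refine LinearMap.ext fun f => ?_
  simp only [Module.End.mul_apply, creator_apply]
  ring

theorem pderiv_comm (r s : ℕ+) (f : Fock) :
    MvPolynomial.pderiv r (MvPolynomial.pderiv s f) =
      MvPolynomial.pderiv s (MvPolynomial.pderiv r f) := by
  have h : ⁅(MvPolynomial.pderiv r : Derivation Scalars Fock Fock), (MvPolynomial.pderiv s :
      Derivation Scalars Fock Fock)⁆ = 0 := by
    refine MvPolynomial.derivation_ext fun i => ?_
    classical
    simp [Derivation.commutator_apply, MvPolynomial.pderiv_X, Pi.single_apply, apply_ite]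
  have h' := congrArg (fun D : Derivation Scalars Fock Fock => D f) h
  simpa only [Derivation.commutator_apply, Derivation.zero_apply, sub_eq_zero] using h'

theorem commute_annihilator (r s : ℕ+) : Commute (annihilator r) (annihilator s) := by
  refine LinearMap.ext fun f => ?_
  simp only [Module.End.mul_apply, annihilator_apply, map_smul, pderiv_comm r s]
  rw [smul_comm]

theorem annihilator_mul_creator (r s : ℕ+) :
    annihilator r * creator s =
      creator s * annihilator r + if r = s then heisenberg r • 1 else 0 := by
  refine LinearMap.ext fun f => ?_
  simp only [Module.End.mul_apply, creator_apply, annihilator_apply, LinearMap.add_apply,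
    MvPolynomial.pderiv_mul, smul_add, mul_smul_comm]
  rw [add_comm]
  congr 1
  classical
  split_ifs with h
  · subst h
    simp
  · rw [MvPolynomial.pderiv_X_of_ne (Ne.symm h)]
    simp

theorem coeffCommute_minusExponent (p p' : ℕ → Scalars) :
    CoeffCommute (minusExponent p) (minusExponent p') := fun i j => by
  rw [minusExponent, minusExponent, coeff_mk, coeff_mk]
  split_ifs
  · exact ((commute_creator _ _).smul_left _).smul_right _
  · exact Commute.zero_right _
  · exact Commute.zero_left _
  · exact Commute.zero_left _

theorem coeffCommute_plusExponent (p p' : ℕ → Scalars) :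
    CoeffCommute (plusExponent p) (plusExponent p') := fun i j => by
  rw [plusExponent, plusExponent, coeff_mk, coeff_mk]
  split_ifs
  · exact ((commute_annihilator _ _).smul_left _).smul_right _
  · exact Commute.zero_right _
  · exact Commute.zero_left _
  · exact Commute.zero_left _

/-- `E₋⁺`, as a power series. -/
def minusSeries (p : ℕ → Scalars) : PowerSeries (Module.End Scalars Fock) :=
  expSeries Scalars (minusExponent p)

/-- `E₊⁺`, as a power series in the inverse variable. -/
def plusSeries (p : ℕ → Scalars) : PowerSeries (Module.End Scalars Fock) :=
  expSeries Scalars (plusExponent p)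

theorem minusSeries_add (p p' : ℕ → Scalars) :
    minusSeries (p + p') = minusSeries p * minusSeries p' := by
  rw [minusSeries, minusExponent_add]
  exact expSeries_add Scalars (coeff_zero_minusExponent p) (coeff_zero_minusExponent p')
    (coeffCommute_minusExponent p p) (coeffCommute_minusExponent p' p')
    (coeffCommute_minusExponent p p')

theorem plusSeries_add (p p' : ℕ → Scalars) :
    plusSeries (p + p') = plusSeries p * plusSeries p' := by
  rw [plusSeries, plusExponent_add]
  exact expSeries_add Scalars (coeff_zero_plusExponent p) (coeff_zero_plusExponent p')
    (coeffCommute_plusExponent p p) (coeffCommute_plusExponent p' p')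
    (coeffCommute_plusExponent p p')

/-- `E₊⁺(w) a(-r) = (a(-r) + t w^r) E₊⁺(w)` with a scalar `t`: the operator `E₊⁺` shifts the
variables of the Fock space. -/
theorem plusSeries_mul_creator (p : ℕ → Scalars) (r : ℕ+) :
    plusSeries p * C (creator r) = (C (creator r) +
      (-(fjCoeff r * p r * heisenberg r)) • X ^ (r : ℕ)) * plusSeries p := by
  refine expSeries_mul_C Scalars (coeff_zero_plusExponent p) (coeffCommute_plusExponent p p) ?_
    ?_ ?_
  · rw [coeff_smul, coeff_X_pow, if_neg r.ne_zero.symm, smul_zero]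
  · intro i a
    rw [coeff_smul, coeff_X_pow]
    split_ifs
    · exact (Commute.one_left a).smul_left _
    · rw [smul_zero]
      exact Commute.zero_left _
  · ext1 n
    rw [coeff_mul_C, map_add, coeff_C_mul, coeff_smul, coeff_X_pow]
    rcases n.eq_zero_or_pos with rfl | hn
    · rw [coeff_zero_plusExponent, if_neg r.ne_zero.symm]
      simp
    · obtain ⟨m, rfl⟩ : ∃ m : ℕ+, n = m := ⟨⟨n, hn⟩, rfl⟩
      rw [coeff_plusExponent, smul_mul_assoc, annihilator_mul_creator, smul_add, mul_smul_comm]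
      congr 1
      by_cases h : m = r
      · rw [if_pos h, if_pos (PNat.coe_inj.2 h), smul_smul, h]
        congr 1
        ring
      · rw [if_neg h, if_neg fun h' => h (PNat.coe_inj.1 h'), smul_zero, smul_zero]

theorem coeff_plusSeries_creator (p : ℕ → Scalars) (r : ℕ+) (n : ℕ) (f : Fock) :
    coeff n (plusSeries p) (creator r f) = creator r (coeff n (plusSeries p) f) +
      if (r : ℕ) ≤ n then (-(fjCoeff r * p r * heisenberg r)) •
        coeff (n - r) (plusSeries p) f else 0 := by
  have h := congrArg (coeff n) (plusSeries_mul_creator p r)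
  rw [coeff_mul_C, add_mul, map_add, coeff_C_mul, smul_mul_assoc, coeff_smul,
    coeff_X_pow_mul'] at h
  have := LinearMap.congr_fun h f
  rw [Module.End.mul_apply, LinearMap.add_apply, Module.End.mul_apply] at this
  rw [this]
  split_ifs <;> simp

theorem coeff_plusSeries_C (p : ℕ → Scalars) {n : ℕ} (hn : 0 < n) (c : Scalars) :
    coeff n (plusSeries p) (MvPolynomial.C c) = 0 := by
  rw [plusSeries, expSeries, coeff_mk, Finset.sum_range_succ', pow_zero, coeff_one,
    if_neg hn.ne', smul_zero, add_zero, LinearMap.sum_apply]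
  refine Finset.sum_eq_zero fun k _ => ?_
  rw [LinearMap.smul_apply, pow_succ, coeff_mul, LinearMap.sum_apply, Finset.sum_eq_zero, smul_zero]
  intro x _
  rw [Module.End.mul_apply]
  rcases x.2.eq_zero_or_pos with h | h
  · rw [h, coeff_zero_plusExponent, LinearMap.zero_apply, map_zero]
  · obtain ⟨m, hm⟩ : ∃ m : ℕ+, x.2 = m := ⟨⟨x.2, h⟩, rfl⟩
    rw [hm, coeff_plusExponent, LinearMap.smul_apply, annihilator_apply, MvPolynomial.pderiv_C,
      smul_zero, smul_zero, map_zero]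

theorem coeff_zero_plusSeries (p : ℕ → Scalars) : coeff 0 (plusSeries p) = 1 :=
  coeff_zero_expSeries _ _

/-- The operator `E₊⁺` maps every vector of the Fock space to a polynomial in the inverse
variable. -/
theorem exists_coeff_plusSeries_eq_zero (p : ℕ → Scalars) (f : Fock) :
    ∃ B : ℕ, ∀ n ≥ B, coeff n (plusSeries p) f = 0 := by
  induction f using MvPolynomial.induction_on with
  | C c => exact ⟨1, fun n hn => coeff_plusSeries_C p hn c⟩
  | add f g hf hg =>
    obtain ⟨B, hB⟩ := hf
    obtain ⟨B', hB'⟩ := hg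
    exact ⟨max B B', fun n hn => by
      rw [map_add, hB n (le_of_max_le_left hn), hB' n (le_of_max_le_right hn), add_zero]⟩
  | mul_X f r hf =>
    obtain ⟨B, hB⟩ := hf
    refine ⟨B + r, fun n hn => ?_⟩
    rw [mul_comm, ← creator_apply, coeff_plusSeries_creator, hB n (by omega), hB (n - r) (by omega)]
    simp

/-- The exponent of the contraction of `E₊⁺` and `E₋⁺`. -/
def contractionExponent (p p' : ℕ → Scalars) : PowerSeries Scalars :=
  PowerSeries.mk fun r : ℕ => -((1 + qq ^ (-(r : ℤ))) * (p r * p' r) / (r : Scalars))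

/-- A series whose `k`th coefficient is `c k • X ^ k` has an exponential of the same form. -/
theorem coeff_expSeries_smul_X_pow {A : Type*} [Ring A] [Algebra Scalars A]
    (f : PowerSeries Scalars) (k : ℕ) :
    coeff k (expSeries Scalars (PowerSeries.mk fun n => coeff n f • (X : PowerSeries A) ^ n)) =
      coeff k (expSeries Scalars f) • X ^ k := by
  have hpow : ∀ n k, coeff k ((PowerSeries.mk fun n => coeff n f • (X : PowerSeries A) ^ n) ^ n) =
      coeff k (f ^ n) • X ^ k := by
    intro n
    induction n with
    | zero =>
      intro k
      rcases eq_or_ne k 0 with rfl | hk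
      · simp
      · simp [coeff_one, hk]
    | succ n ih =>
      intro k
      rw [pow_succ, pow_succ, coeff_mul, coeff_mul, Finset.sum_smul]
      refine Finset.sum_congr rfl fun x hx => ?_
      rw [ih, coeff_mk, smul_mul_smul_comm, ← pow_add,
        Finset.HasAntidiagonal.mem_antidiagonal.1 hx]
  rw [expSeries, expSeries, coeff_mk, coeff_mk, Finset.sum_smul]
  exact Finset.sum_congr rfl fun n _ => by rw [hpow, smul_assoc]

/-- The commutation of `E₊⁺` with `E₋⁺`, in terms of coefficients. Over the ring of power series in
the inverse variable, conjugation by `E₊⁺` adds a central series to the exponent of `E₋⁺`, hence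
multiplies `E₋⁺` by the exponential of that series. -/
theorem coeff_plusSeries_mul_coeff_minusSeries (p p' : ℕ → Scalars) (a n : ℕ) :
    coeff a (plusSeries p) * coeff n (minusSeries p') =
      ∑ x ∈ Finset.HasAntidiagonal.antidiagonal n,
        coeff x.1 (expSeries Scalars (contractionExponent p p')) •
        if x.1 ≤ a then coeff x.2 (minusSeries p') * coeff (a - x.1) (plusSeries p) else 0 := by
  set φ : Module.End Scalars Fock →ₐ[Scalars] PowerSeries (Module.End Scalars Fock) :=
    { (C : Module.End Scalars Fock →+* PowerSeries (Module.End Scalars Fock)) with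
      commutes' := fun c => by
        ext1 n
        rw [Algebra.algebraMap_eq_smul_one, Algebra.algebraMap_eq_smul_one, coeff_smul]
        change coeff n (C _) = _
        rw [coeff_C, coeff_one]
        split_ifs <;> simp } with hφ
  have hφC : ∀ x, (φ : Module.End Scalars Fock →+* PowerSeries (Module.End Scalars Fock)) x = C x :=
    fun _ => rfl
  have hsmul : ∀ (c : Scalars) (x : Module.End Scalars Fock),
      (C (c • x) : PowerSeries _) = c • C x :=
    fun c x => map_smul φ c x
  set η := PowerSeries.map (φ : Module.End Scalars Fock →+* PowerSeries (Module.End Scalars Fock))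
    (minusExponent p') with hη
  set ρ : PowerSeries (PowerSeries (Module.End Scalars Fock)) :=
    PowerSeries.mk fun n => coeff n (contractionExponent p p') • X ^ n with hρ
  have hρc : ∀ g, CoeffCommute ρ g := fun g i j => by
    rw [hρ, coeff_mk]
    exact (commute_X_pow _ _).symm.smul_left _
  have hη₀ : coeff 0 η = 0 := by rw [hη, coeff_map, coeff_zero_minusExponent, map_zero]
  have hρ₀ : coeff 0 ρ = 0 := by
    rw [hρ, coeff_mk]
    simp [contractionExponent]
  have hηη : CoeffCommute η η := fun i j => by
    rw [hη, coeff_map, coeff_map]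
    exact (coeffCommute_minusExponent p' p' i j).map _
  have hsemi : SemiconjBy (C (plusSeries p)) η (ρ + η) := by
    ext1 n
    rw [coeff_C_mul, coeff_mul_C, map_add]
    rcases n.eq_zero_or_pos with rfl | hn
    · rw [hη₀, hρ₀, mul_zero, add_zero, zero_mul]
    · obtain ⟨r, rfl⟩ : ∃ r : ℕ+, n = r := ⟨⟨n, hn⟩, rfl⟩
      have hr : ((r : ℕ) : Scalars) ≠ 0 := Nat.cast_ne_zero.2 r.ne_zero
      have hc := fjCoeff_sq_mul_heisenberg r
      rw [hη, coeff_map, coeff_minusExponent, hφC, hsmul, hρ, coeff_mk, mul_smul_comm,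
        plusSeries_mul_creator, contractionExponent, coeff_mk, add_mul, add_mul, smul_add,
        smul_mul_assoc, smul_mul_assoc, smul_smul, smul_mul_assoc, add_comm]
      congr 2
      rw [show fjCoeff r * p' r * -(fjCoeff r * p r * heisenberg r) =
        -(fjCoeff r * fjCoeff r * heisenberg r) * (p r * p' r) by ring, hc]
      ring
  have key := semiconjBy_expSeries Scalars hsemi
  rw [expSeries_add Scalars hρ₀ hη₀ (hρc ρ) hηη (hρc η), hη, ← map_expSeries] at key
  have h := congrArg (coeff n) key.eq
  rw [coeff_C_mul, coeff_mul_C, coeff_mul, coeff_map, hφC] at h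
  have h' := congrArg (coeff a) h
  rw [coeff_mul_C] at h'
  rw [minusSeries, h', Finset.sum_mul, map_sum]
  refine Finset.sum_congr rfl fun x _ => ?_
  rw [hρ, coeff_expSeries_smul_X_pow, coeff_map, hφC, smul_mul_assoc, smul_mul_assoc, coeff_smul,
    (commute_X_pow _ _).symm.eq, mul_assoc, coeff_C_mul, coeff_X_pow_mul']
  split_ifs <;> simp

end Heisenberg

/-! ### Vertex operators on the Fock space -/

section FockVertex

open PowerSeries

local infixl:70 " ⋆ " => mulSeries

theorem expMinus_natCast (p : ℕ → Scalars) (n : ℕ) : expMinus p n = coeff n (minusSeries p) := by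
  rw [expMinus, if_pos (Int.natCast_nonneg n), Int.toNat_natCast, minusSeries, expSeries, coeff_mk]
  rfl

theorem expMinus_of_neg (p : ℕ → Scalars) {n : ℤ} (hn : n < 0) : expMinus p n = 0 :=
  if_neg (not_le.2 hn)

theorem expPlus_neg_natCast (p : ℕ → Scalars) (n : ℕ) :
    expPlus p (-n) = coeff n (plusSeries p) := by
  rw [expPlus, if_pos (by omega), neg_neg, Int.toNat_natCast, plusSeries, expSeries, coeff_mk]
  rfl

theorem expPlus_of_pos (p : ℕ → Scalars) {n : ℤ} (hn : 0 < n) : expPlus p n = 0 :=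
  if_neg (not_le.2 hn)

theorem exists_expPlus_eq_zero (p : ℕ → Scalars) (f : Fock) :
    ∃ B : ℕ, ∀ n : ℤ, (B : ℤ) ≤ n → expPlus p (-n) f = 0 := by
  obtain ⟨B, hB⟩ := exists_coeff_plusSeries_eq_zero p f
  refine ⟨B, fun n hn => ?_⟩
  lift n to ℕ using by omega
  rw [expPlus_neg_natCast]
  exact hB n (by omega)

/-- The normal ordering of `E₊⁺ E₋⁺`, when the contraction is a polynomial. -/
theorem expPlus_mul_expMinus {p p' : ℕ → Scalars} {K : ℕ}
    (hK : ∀ k ≥ K, coeff k (expSeries Scalars (contractionExponent p p')) = 0) (a n : ℤ) :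
    expPlus p (-a) * expMinus p' n = ∑ k ∈ Finset.range K,
      coeff k (expSeries Scalars (contractionExponent p p')) •
        (expMinus p' (n - k) * expPlus p (-(a - k))) := by
  rcases lt_or_ge n 0 with hn | hn
  · rw [expMinus_of_neg p' hn, mul_zero, Finset.sum_eq_zero]
    intro k _
    rw [expMinus_of_neg p' (by omega), zero_mul, smul_zero]
  rcases lt_or_ge a 0 with ha | ha
  · rw [expPlus_of_pos p (by omega), zero_mul, Finset.sum_eq_zero]
    intro k _
    rw [expPlus_of_pos p (by omega), mul_zero, smul_zero]
  lift n to ℕ using hn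
  lift a to ℕ using ha
  set Γ := expSeries Scalars (contractionExponent p p')
  have h₁ : ∑ k ∈ Finset.range K, coeff k Γ • (expMinus p' (n - k) * expPlus p (-(a - k))) =
      ∑ k ∈ Finset.range (max K (n + 1)),
        coeff k Γ • (expMinus p' (n - k) * expPlus p (-(a - k))) := by
    refine Finset.sum_subset (by simp) fun k _ hk => ?_
    rw [hK k (by simpa using hk), zero_smul]
  have h₂ : ∑ k ∈ Finset.range (n + 1), coeff k Γ • (expMinus p' (n - k) * expPlus p (-(a - k))) =
      ∑ k ∈ Finset.range (max K (n + 1)),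
        coeff k Γ • (expMinus p' (n - k) * expPlus p (-(a - k))) := by
    refine Finset.sum_subset (by simp) fun k _ hk => ?_
    have : ¬ k < n + 1 := by simpa using hk
    rw [expMinus_of_neg p' (by omega), zero_mul, smul_zero]
  rw [h₁, ← h₂, expPlus_neg_natCast, expMinus_natCast, coeff_plusSeries_mul_coeff_minusSeries,
    Finset.Nat.sum_antidiagonal_eq_sum_range_succ (fun k m => coeff k Γ •
      if k ≤ a then coeff m (minusSeries p') * coeff (a - k) (plusSeries p) else 0)]
  refine Finset.sum_congr rfl fun k hk => ?_
  have hk' := Finset.mem_range.1 hk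
  rw [← Nat.cast_sub (by omega), expMinus_natCast]
  split_ifs with h
  · rw [← Nat.cast_sub h, expPlus_neg_natCast]
  · rw [expPlus_of_pos p (by omega), mul_zero]

theorem quasiCommutative_expMinus (p p' : ℕ → Scalars) :
    QuasiCommutative (expMinus p) (expMinus p') := fun v => ⟨0, fun i j hij => by
  rcases hij with h | h
  · rw [expMinus_of_neg p h, LinearMap.zero_apply]
  · rw [expMinus_of_neg p' h, LinearMap.zero_apply, map_zero]⟩

theorem expMinus_mulSeries_expMinus (p p' : ℕ → Scalars) :
    expMinus p ⋆ expMinus p' = expMinus (p + p') := by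
  ext1 n
  refine LinearMap.ext fun v => ?_
  rw [mulSeries_apply (quasiCommutative_expMinus p p')]
  rcases lt_or_ge n 0 with hn | hn
  · rw [expMinus_of_neg _ hn, LinearMap.zero_apply]
    refine finsum_eq_zero_of_forall_eq_zero fun i => ?_
    rcases lt_or_ge i 0 with hi | hi
    · rw [expMinus_of_neg p hi, LinearMap.zero_apply]
    · rw [expMinus_of_neg p' (by omega), LinearMap.zero_apply, map_zero]
  lift n to ℕ using hn
  rw [expMinus_natCast, minusSeries_add, coeff_mul, LinearMap.sum_apply,
    Finset.Nat.sum_antidiagonal_eq_sum_range_succ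
      (fun i j => (coeff i (minusSeries p) * coeff j (minusSeries p')) v),
    finsum_eq_sum_of_support_subset (s := (Finset.range (n + 1)).map Nat.castEmbedding),
    Finset.sum_map]
  · refine Finset.sum_congr rfl fun i hi => ?_
    have := Finset.mem_range.1 hi
    rw [Nat.castEmbedding_apply, ← Nat.cast_sub (by omega), expMinus_natCast, expMinus_natCast]
    rfl
  · intro i hi
    have h0 : 0 ≤ i := by
      by_contra h
      exact hi (by simp only [expMinus_of_neg p (not_le.1 h), LinearMap.zero_apply])
    have h1 : i ≤ n := by
      by_contra h
      exact hi (by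
        simp only [expMinus_of_neg p' (show (n : ℤ) - i < 0 by omega), LinearMap.zero_apply,
          map_zero])
    lift i to ℕ using h0
    simp only [Finset.coe_map, Set.mem_image, Finset.coe_range, Set.mem_Iio]
    exact ⟨i, by omega, rfl⟩

theorem expPlus_add_neg_natCast (p p' : ℕ → Scalars) (n : ℕ) (f : Fock) :
    expPlus (p + p') (-n) f =
      ∑ x ∈ Finset.HasAntidiagonal.antidiagonal n, expPlus p (-x.1) (expPlus p' (-x.2) f) := by
  rw [expPlus_neg_natCast, plusSeries_add, coeff_mul, LinearMap.sum_apply]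
  simp only [expPlus_neg_natCast]
  rfl

/-- The normally ordered product of `E₋⁺` and `E₊⁺`. -/
def fockVertex (p p' : ℕ → Scalars) : OpSeries Scalars Fock := expMinus p ⋆ expPlus p'

theorem fockVertex_apply (p p' : ℕ → Scalars) {f : Fock} {B : ℕ}
    (hB : ∀ b : ℤ, (B : ℤ) ≤ b → expPlus p' (-b) f = 0) (n : ℤ) :
    fockVertex p p' n f = ∑ b ∈ Finset.range B, expMinus p (n + b) (expPlus p' (-b) f) := by
  have hqc : QuasiCommutative (expMinus p) (expPlus p') := fun v => by
    obtain ⟨B, hB⟩ := exists_expPlus_eq_zero p' v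
    refine ⟨-B, fun i j hij => ?_⟩
    rcases hij with h | h
    · rw [expMinus_of_neg p (by omega), LinearMap.zero_apply]
    · rw [← neg_neg j, hB (-j) (by omega), map_zero]
  have hinj : Function.Injective fun b : ℕ => n + (b : ℤ) := fun a b h => by
    simpa using h
  rw [fockVertex, mulSeries_apply hqc,
    finsum_eq_sum_of_support_subset (s := (Finset.range B).map ⟨_, hinj⟩), Finset.sum_map]
  · refine Finset.sum_congr rfl fun b _ => ?_
    simp only [Function.Embedding.coeFn_mk, sub_add_cancel_left]
  · intro i hi
    have h0 : n ≤ i := by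
      by_contra h
      exact hi (by
        simp only [expPlus_of_pos p' (show 0 < n - i by omega), LinearMap.zero_apply, map_zero])
    have h1 : i < n + B := by
      by_contra h
      refine hi ?_
      have := hB (i - n) (by omega)
      rw [neg_sub] at this
      simp only [this, map_zero]
    simp only [Finset.coe_map, Set.mem_image, Finset.coe_range, Set.mem_Iio,
      Function.Embedding.coeFn_mk]
    exact ⟨(i - n).toNat, by omega, by omega⟩

theorem sum_range_add_shift {M : Type*} [AddCommMonoid M] {φ : ℤ → M} {B K k : ℕ} (hk : k ≤ K)
    (h₀ : ∀ x < 0, φ x = 0) (h₁ : ∀ x : ℤ, (B : ℤ) ≤ x → φ x = 0) :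
    ∑ a ∈ Finset.range (B + K), φ (a - k) = ∑ a ∈ Finset.range B, φ a := by
  rw [← Finset.sum_subset (s₁ := (Finset.range B).map (addRightEmbedding k)), Finset.sum_map]
  · simp
  · intro a ha
    simp only [Finset.mem_map, Finset.mem_range, addRightEmbedding_apply] at ha ⊢
    omega
  · intro a _ ha
    simp only [Finset.mem_map, Finset.mem_range, addRightEmbedding_apply, not_exists] at ha
    rcases lt_or_ge a k with h | h
    · exact h₀ _ (by omega)
    · refine h₁ _ ?_
      by_contra hc
      exact ha (a - k) (by omega)

/-- The two-variable normal ordering: a composition of coefficients of two vertex operators is a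
finite combination, independent of the coefficients, of fully normally ordered terms. -/
theorem fockVertex_fockVertex (p p' r r' : ℕ → Scalars) {K : ℕ}
    (hK : ∀ k ≥ K, coeff k (expSeries Scalars (contractionExponent p' r)) = 0) (f : Fock) :
    ∃ B : ℕ, (∀ b : ℤ, (B : ℤ) ≤ b → expPlus r' (-b) f = 0) ∧
      (∀ a : ℤ, (B : ℤ) ≤ a → ∀ b : ℕ, expPlus p' (-a) (expPlus r' (-b) f) = 0) ∧
      ∀ i j : ℤ, fockVertex p p' i (fockVertex r r' j f) =
        ∑ k ∈ Finset.range K, ∑ x ∈ Finset.range B ×ˢ Finset.range B,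
          coeff k (expSeries Scalars (contractionExponent p' r)) •
            expMinus p (i + x.1 + k) (expMinus r (j + x.2 - k)
              (expPlus p' (-x.1) (expPlus r' (-x.2) f))) := by
  obtain ⟨B₁, hB₁⟩ := exists_expPlus_eq_zero r' f
  choose B₂ hB₂ using fun b : ℕ => exists_expPlus_eq_zero p' (expPlus r' (-b) f)
  set B := max B₁ ((Finset.range B₁).sup B₂) with hB
  have h₁ : ∀ b : ℤ, (B : ℤ) ≤ b → expPlus r' (-b) f = 0 := fun b hb => hB₁ b (by omega)
  have h₂ : ∀ a : ℤ, (B : ℤ) ≤ a → ∀ b : ℕ, expPlus p' (-a) (expPlus r' (-b) f) = 0 := by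
    intro a ha b
    rcases lt_or_ge b B₁ with hb | hb
    · refine hB₂ b a ?_
      have := Finset.le_sup (f := B₂) (Finset.mem_range.2 hb)
      omega
    · rw [hB₁ b (by omega), map_zero]
  refine ⟨B, h₁, h₂, fun i j => ?_⟩
  have hcomm : ∀ a m : ℤ, ∀ b : ℕ, expPlus p' (-a) (expMinus r m (expPlus r' (-b) f)) =
      ∑ k ∈ Finset.range K, coeff k (expSeries Scalars (contractionExponent p' r)) •
        expMinus r (m - k) (expPlus p' (-(a - k)) (expPlus r' (-b) f)) := by
    intro a m b
    have := LinearMap.congr_fun (expPlus_mul_expMinus hK a m) (expPlus r' (-b) f)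
    rw [Module.End.mul_apply, LinearMap.sum_apply] at this
    exact this
  have hvan : ∀ m : ℤ, ∀ b : ℕ, ∀ a : ℤ, ((B + K : ℕ) : ℤ) ≤ a →
      expPlus p' (-a) (expMinus r m (expPlus r' (-b) f)) = 0 := by
    intro m b a ha
    rw [hcomm]
    refine Finset.sum_eq_zero fun k hk => ?_
    have := Finset.mem_range.1 hk
    rw [h₂ (a - k) (by omega) b, map_zero, smul_zero]
  simp only [Finset.sum_product_right]
  rw [fockVertex_apply r r' h₁, map_sum, Finset.sum_comm]
  refine Finset.sum_congr rfl fun b _ => ?_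
  rw [fockVertex_apply p p' (hvan (j + b) b)]
  simp only [hcomm, map_sum, map_smul]
  rw [Finset.sum_comm]
  refine Finset.sum_congr rfl fun k hk => ?_
  have hk' := Finset.mem_range.1 hk
  rw [← sum_range_add_shift (φ := fun x : ℤ =>
    coeff k (expSeries Scalars (contractionExponent p' r)) •
      expMinus p (i + x + k) (expMinus r (j + b - k)
        (expPlus p' (-x) (expPlus r' (-b) f)))) hk'.le]
  · refine Finset.sum_congr rfl fun a _ => ?_
    rw [show i + (a - k : ℤ) + k = i + a by ring]
  · intro x hx
    rw [expPlus_of_pos p' (by omega), LinearMap.zero_apply, map_zero, map_zero, smul_zero]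
  · intro x hx
    rw [h₂ x hx, map_zero, map_zero, smul_zero]

theorem quasiCommutative_fockVertex (p p' r r' : ℕ → Scalars) {K : ℕ}
    (hK : ∀ k ≥ K, coeff k (expSeries Scalars (contractionExponent p' r)) = 0) :
    QuasiCommutative (fockVertex p p') (fockVertex r r') := fun f => by
  obtain ⟨B, -, -, hB⟩ := fockVertex_fockVertex p p' r r' hK f
  refine ⟨-(B + K), fun i j hij => ?_⟩
  rw [hB]
  refine Finset.sum_eq_zero fun k hk => Finset.sum_eq_zero fun x hx => ?_
  have hk' := Finset.mem_range.1 hk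
  obtain ⟨hx₁, hx₂⟩ := Finset.mem_product.1 hx
  have hx₁ := Finset.mem_range.1 hx₁
  have hx₂ := Finset.mem_range.1 hx₂
  rcases hij with h | h
  · rw [expMinus_of_neg p (by omega), LinearMap.zero_apply, smul_zero]
  · rw [expMinus_of_neg r (by omega), LinearMap.zero_apply, map_zero, smul_zero]

theorem fockVertex_mulSeries_fockVertex (p p' r r' : ℕ → Scalars) {K : ℕ}
    (hK : ∀ k ≥ K, coeff k (expSeries Scalars (contractionExponent p' r)) = 0) :
    fockVertex p p' ⋆ fockVertex r r' =
      (∑ k ∈ Finset.range K, coeff k (expSeries Scalars (contractionExponent p' r))) •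
        fockVertex (p + r) (p' + r') := by
  ext1 n
  refine LinearMap.ext fun f => ?_
  obtain ⟨B, hB₁, hB₂, hB⟩ := fockVertex_fockVertex p p' r r' hK f
  rw [mulSeries_apply (quasiCommutative_fockVertex p p' r r' hK)]
  have hqc := quasiCommutative_expMinus p r
  have hconv : ∀ x y : ℤ, ∀ w : Fock,
      ∑ᶠ i : ℤ, expMinus p (i + x) (expMinus r (y - i) w) = expMinus (p + r) (x + y) w := by
    intro x y w
    rw [← expMinus_mulSeries_expMinus, mulSeries_apply hqc]
    refine finsum_eq_of_bijective (fun i => i + x) (Equiv.addRight x).bijective fun i => ?_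
    rw [show x + y - (i + x) = y - i by ring]
  have hfin : ∀ c : Scalars, ∀ x y : ℤ, ∀ w : Fock, (Function.support fun i : ℤ =>
      c • expMinus p (i + x) (expMinus r (y - i) w)).Finite := by
    intro c x y w
    refine (Set.finite_Icc (-x) y).subset fun i hi => ?_
    by_contra hc
    refine hi ?_
    dsimp only
    rw [Set.mem_Icc, not_and_or, not_le, not_le] at hc
    rcases hc with h | h
    · rw [expMinus_of_neg p (by omega), LinearMap.zero_apply, smul_zero]
    · rw [expMinus_of_neg r (by omega), LinearMap.zero_apply, map_zero, smul_zero]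
  have hidx : ∀ i : ℤ, fockVertex p p' i (fockVertex r r' (n - i) f) =
      ∑ y ∈ Finset.range K ×ˢ (Finset.range B ×ˢ Finset.range B),
        coeff y.1 (expSeries Scalars (contractionExponent p' r)) •
          expMinus p (i + (y.2.1 + y.1)) (expMinus r (n + y.2.2 - y.1 - i)
            (expPlus p' (-y.2.1) (expPlus r' (-y.2.2) f))) := by
    intro i
    rw [hB, Finset.sum_product]
    refine Finset.sum_congr rfl fun k _ => Finset.sum_congr rfl fun x _ => ?_
    rw [add_assoc i, show n - i + (x.2 : ℤ) - k = n + x.2 - k - i by ring]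
  simp only [hidx]
  rw [finsum_sum_comm _ _ fun y _ => hfin _ _ _ _, Finset.sum_product, Pi.smul_apply,
    LinearMap.smul_apply, Finset.sum_smul]
  refine Finset.sum_congr rfl fun k _ => ?_
  have hterm : ∀ x : ℕ × ℕ, ∑ᶠ i : ℤ, coeff k (expSeries Scalars (contractionExponent p' r)) •
      expMinus p (i + (x.1 + k)) (expMinus r (n + x.2 - k - i)
        (expPlus p' (-x.1) (expPlus r' (-x.2) f))) =
      coeff k (expSeries Scalars (contractionExponent p' r)) •
        expMinus (p + r) (n + (x.1 + x.2 : ℕ)) (expPlus p' (-x.1) (expPlus r' (-x.2) f)) := by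
    intro x
    rw [← smul_finsum, hconv]
    congr 3
    push_cast
    ring
  simp only [hterm]
  rw [← Finset.smul_sum]
  congr 1
  have hplus : ∀ c : ℤ, ((2 * B : ℕ) : ℤ) ≤ c → expPlus (p' + r') (-c) f = 0 := by
    intro c hc
    lift c to ℕ using by omega
    rw [expPlus_add_neg_natCast]
    refine Finset.sum_eq_zero fun x hx => ?_
    have := Finset.HasAntidiagonal.mem_antidiagonal.1 hx
    rcases lt_or_ge x.1 B with h | h
    · rw [hB₁ x.2 (by omega), map_zero]
    · exact hB₂ x.1 (by omega) _
  rw [fockVertex_apply _ _ hplus]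
  simp only [expPlus_add_neg_natCast, map_sum]
  rw [← Finset.sum_fiberwise_of_maps_to (t := Finset.range (2 * B)) (g := fun x => x.1 + x.2)]
  · refine Finset.sum_congr rfl fun c _ => ?_
    refine (Finset.sum_subset (fun x hx => ?_) fun x hx hx' => ?_).trans
      (Finset.sum_congr rfl fun x hx => ?_)
    · exact Finset.HasAntidiagonal.mem_antidiagonal.2 (Finset.mem_filter.1 hx).2
    · have hsum := Finset.HasAntidiagonal.mem_antidiagonal.1 hx
      simp only [Finset.mem_filter, Finset.mem_product, Finset.mem_range, not_and] at hx'
      rcases lt_or_ge x.1 B with h | h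
      · rw [hB₁ x.2 (by by_contra h'; exact hx' ⟨h, by omega⟩ hsum), map_zero, map_zero]
      · rw [hB₂ x.1 (by omega), map_zero]
    · rw [Finset.HasAntidiagonal.mem_antidiagonal.1 hx]
  · intro x hx
    simp only [Finset.mem_product, Finset.mem_range] at hx ⊢
    omega

end FockVertex

/-! ### Normally ordered products of Frenkel-Jing operators -/

section VertexOp

open PowerSeries

local infixl:70 " ⋆ " => mulSeries

theorem qq_ne_zero : qq ≠ 0 := notRootOfUnity_qq.1

theorem expMinus_zero : expMinus 0 = idSeries Scalars Fock := by
  have h : minusExponent 0 = 0 := by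
    ext1 n
    simp [minusExponent]
  ext1 n
  rcases lt_or_ge n 0 with hn | hn
  · rw [expMinus_of_neg _ hn, idSeries, if_neg (by omega)]
  · lift n to ℕ using hn
    rw [expMinus_natCast, minusSeries, h, expSeries_zero, coeff_one, idSeries]
    simp only [Nat.cast_eq_zero]
    rfl

theorem expPlus_zero : expPlus 0 = idSeries Scalars Fock := by
  have h : plusExponent 0 = 0 := by
    ext1 n
    simp [plusExponent]
  ext1 n
  rcases lt_or_ge 0 n with hn | hn
  · rw [expPlus_of_pos _ hn, idSeries, if_neg (by omega)]
  · obtain ⟨m, rfl⟩ : ∃ m : ℕ, n = -m := ⟨(-n).toNat, by omega⟩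
    rw [expPlus_neg_natCast, plusSeries, h, expSeries_zero, coeff_one, idSeries]
    simp only [neg_eq_zero, Nat.cast_eq_zero]
    rfl

theorem fockVertex_zero : fockVertex 0 0 = idSeries Scalars Fock := by
  rw [fockVertex, expMinus_zero, expPlus_zero]
  refine idSeries_mulSeries fun v => ⟨0, fun i j hij => ?_⟩
  rcases hij with h | h
  · simp [idSeries, h.ne]
  · simp [idSeries, h.ne]

theorem coeff_expSeries_rescale {A : Type*} [Ring A] [Algebra Scalars A] {f g : PowerSeries A}
    {β : Scalars} (h : ∀ k, coeff k g = β ^ k • coeff k f) (k : ℕ) :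
    coeff k (expSeries Scalars g) = β ^ k • coeff k (expSeries Scalars f) := by
  have hpow : ∀ n k, coeff k (g ^ n) = β ^ k • coeff k (f ^ n) := by
    intro n
    induction n with
    | zero =>
      intro k
      rcases eq_or_ne k 0 with rfl | hk
      · simp
      · simp [coeff_one, hk]
    | succ n ih =>
      intro k
      rw [pow_succ, pow_succ, coeff_mul, coeff_mul, Finset.smul_sum]
      refine Finset.sum_congr rfl fun x hx => ?_
      rw [ih, h, smul_mul_smul_comm, ← pow_add, Finset.HasAntidiagonal.mem_antidiagonal.1 hx]
  rw [expSeries, expSeries, coeff_mk, coeff_mk, Finset.smul_sum]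
  exact Finset.sum_congr rfl fun n _ => by rw [hpow, smul_comm]

theorem scale_expMinus (β : Scalars) (p : ℕ → Scalars) :
    scale β (expMinus p) = expMinus fun r => β ^ r * p r := by
  ext1 n
  rcases lt_or_ge n 0 with hn | hn
  · rw [scale, expMinus_of_neg _ hn, expMinus_of_neg _ hn, smul_zero]
  · lift n to ℕ using hn
    rw [scale, expMinus_natCast, expMinus_natCast, zpow_natCast]
    refine (coeff_expSeries_rescale (fun k => ?_) n).symm
    rcases k.eq_zero_or_pos with rfl | hk
    · rw [coeff_zero_minusExponent, coeff_zero_minusExponent, smul_zero]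
    · obtain ⟨m, rfl⟩ : ∃ m : ℕ+, k = m := ⟨⟨k, hk⟩, rfl⟩
      rw [coeff_minusExponent, coeff_minusExponent, smul_smul]
      congr 1
      ring

theorem scale_expPlus (β : Scalars) (p : ℕ → Scalars) :
    scale β (expPlus p) = expPlus fun r => β⁻¹ ^ r * p r := by
  ext1 n
  rcases lt_or_ge 0 n with hn | hn
  · rw [scale, expPlus_of_pos _ hn, expPlus_of_pos _ hn, smul_zero]
  · obtain ⟨m, rfl⟩ : ∃ m : ℕ, n = -m := ⟨(-n).toNat, by omega⟩
    rw [scale, expPlus_neg_natCast, expPlus_neg_natCast, zpow_neg, zpow_natCast, ← inv_pow]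
    refine (coeff_expSeries_rescale (fun k => ?_) m).symm
    rcases k.eq_zero_or_pos with rfl | hk
    · rw [coeff_zero_plusExponent, coeff_zero_plusExponent, smul_zero]
    · obtain ⟨m, rfl⟩ : ∃ m : ℕ+, k = m := ⟨⟨k, hk⟩, rfl⟩
      rw [coeff_plusExponent, coeff_plusExponent, smul_smul]
      congr 1
      ring

/-- The power sums `∑_{l ∈ s} qq^{l r}`. -/
def powerSum (s : Multiset ℤ) (r : ℕ) : Scalars := (s.map fun l => qq ^ (l * (r : ℤ))).sum

/-- The power sums `∑_{l ∈ s} qq^{-l r}`. -/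
def powerSumInv (s : Multiset ℤ) (r : ℕ) : Scalars := (s.map fun l => qq ^ (-(l * (r : ℤ)))).sum

theorem powerSum_add (s t : Multiset ℤ) : powerSum (s + t) = powerSum s + powerSum t := by
  funext r
  simp [powerSum]

theorem powerSumInv_add (s t : Multiset ℤ) :
    powerSumInv (s + t) = powerSumInv s + powerSumInv t := by
  funext r
  simp [powerSumInv]

theorem fockVertex_powerSum_shift (s : Multiset ℤ) :
    fockVertex (powerSum (s.map (· + 1))) (powerSumInv (s.map (· + 1))) =
      scale qq (fockVertex (powerSum s) (powerSumInv s)) := by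
  have hqc : ∀ p p', QuasiCommutative (expMinus p) (expPlus p') := fun p p' v => by
    obtain ⟨B, hB⟩ := exists_expPlus_eq_zero p' v
    refine ⟨-B, fun i j hij => ?_⟩
    rcases hij with h | h
    · rw [expMinus_of_neg p (by omega), LinearMap.zero_apply]
    · rw [← neg_neg j, hB (-j) (by omega), map_zero]
  have h₁ : powerSum (s.map (· + 1)) = fun r => qq ^ r * powerSum s r := by
    funext r
    rw [powerSum, powerSum, Multiset.map_map, ← Multiset.sum_map_mul_left]
    refine congrArg Multiset.sum (Multiset.map_congr rfl fun l _ => ?_)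
    rw [Function.comp_apply, ← zpow_natCast, ← zpow_add₀ qq_ne_zero]
    congr 1
    ring
  have h₂ : powerSumInv (s.map (· + 1)) = fun r => qq⁻¹ ^ r * powerSumInv s r := by
    funext r
    rw [powerSumInv, powerSumInv, Multiset.map_map, ← Multiset.sum_map_mul_left]
    refine congrArg Multiset.sum (Multiset.map_congr rfl fun l _ => ?_)
    rw [Function.comp_apply, ← zpow_natCast, inv_zpow', ← zpow_add₀ qq_ne_zero]
    congr 1
    ring
  rw [h₁, h₂, fockVertex, fockVertex, scale_mulSeries qq_ne_zero (hqc _ _), scale_expMinus,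
    scale_expPlus]
  rw [scale_expMinus, scale_expPlus]
  exact hqc _ _

/-- The contraction `∏_{a ∈ s, b ∈ t} (qq^a - qq^b) (qq^a - qq^{b-1})`. -/
def contraction (s t : Multiset ℤ) : Scalars :=
  (s.map fun a => (t.map fun b => (qq ^ a - qq ^ b) * (qq ^ a - qq ^ (b - 1))).prod).prod

theorem contraction_add_left (s s' t : Multiset ℤ) :
    contraction (s + s') t = contraction s t * contraction s' t := by
  simp [contraction]

theorem contraction_add_right (s t t' : Multiset ℤ) :
    contraction s (t + t') = contraction s t * contraction s t' := by
  simp [contraction, Multiset.prod_map_mul]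

/-- The inverse roots, in the variable `z₂ / z₁`, of the contraction of the normally ordered
products with shifts `s` at `z₁` and `t` at `z₂`. -/
def contractionRoots (s t : Multiset ℤ) : Multiset Scalars :=
  s.bind fun a => t.bind fun b => {qq ^ (b - a), qq ^ (b - a - 1)}

theorem expSeries_contractionExponent (s t : Multiset ℤ) :
    expSeries Scalars (contractionExponent (powerSumInv s) (powerSum t)) =
      ((contractionRoots s t).map fun β => 1 - C β * X).prod := by
  rw [← expSeries_neg_log]
  congr 1
  ext1 r
  rw [contractionExponent, coeff_mk, coeff_mk]
  congr 2
  rw [contractionRoots, Multiset.map_bind, Multiset.sum_bind, powerSumInv, powerSum,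
    ← Multiset.sum_map_mul_right, ← Multiset.sum_map_mul_left]
  refine congrArg Multiset.sum (Multiset.map_congr rfl fun a _ => ?_)
  rw [Multiset.map_bind, Multiset.sum_bind, ← Multiset.sum_map_mul_left,
    ← Multiset.sum_map_mul_left]
  refine congrArg Multiset.sum (Multiset.map_congr rfl fun b _ => ?_)
  simp only [Multiset.insert_eq_cons, Multiset.map_cons, Multiset.map_singleton,
    Multiset.sum_cons, Multiset.sum_singleton, ← zpow_natCast, ← zpow_mul, add_mul, one_mul,
    ← zpow_add₀ qq_ne_zero]
  congr 2 <;> ring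

/-- The contraction of two normally ordered products is a polynomial in `z₂ / z₁`. Its value at
`z₁ = z₂`, times the scalar that comes from moving `e^α` past `(z qq^l)^{∂_α}`, is
`contraction s t`. -/
theorem exists_contraction_bound (s t : Multiset ℤ) :
    ∃ K : ℕ, (∀ k ≥ K, coeff k (expSeries Scalars
        (contractionExponent (powerSumInv s) (powerSum t))) = 0) ∧
      qq ^ (2 * (t.card : ℤ) * s.sum) * ∑ k ∈ Finset.range K, coeff k (expSeries Scalars
        (contractionExponent (powerSumInv s) (powerSum t))) = contraction s t := by
  set P : Polynomial Scalars :=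
    ((contractionRoots s t).map fun β => 1 - Polynomial.C β * Polynomial.X).prod with hP
  have hcoe : expSeries Scalars (contractionExponent (powerSumInv s) (powerSum t)) =
      (P : PowerSeries Scalars) := by
    rw [expSeries_contractionExponent, hP, ← Polynomial.coeToPowerSeries.ringHom_apply,
      map_multiset_prod, Multiset.map_map]
    refine congrArg Multiset.prod (Multiset.map_congr rfl fun β _ => ?_)
    simp
  refine ⟨P.natDegree + 1, fun k hk => ?_, ?_⟩
  · rw [hcoe, Polynomial.coeff_coe, Polynomial.coeff_eq_zero_of_natDegree_lt (by omega)]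
  · have heval : ∑ k ∈ Finset.range (P.natDegree + 1), coeff k (P : PowerSeries Scalars) =
        P.eval 1 := by
      rw [Polynomial.eval_eq_sum_range]
      simp
    rw [hcoe, heval, hP, Polynomial.eval_multiset_prod, Multiset.map_map]
    have hroot : ∀ a b : ℤ, (qq ^ a - qq ^ b) * (qq ^ a - qq ^ (b - 1)) =
        qq ^ (2 * a) * ((1 - qq ^ (b - a)) * (1 - qq ^ (b - a - 1))) := by
      intro a b
      have h₁ : qq ^ b = qq ^ a * qq ^ (b - a) := by
        rw [← zpow_add₀ qq_ne_zero]
        congr 1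
        ring
      have h₂ : qq ^ (b - 1) = qq ^ a * qq ^ (b - a - 1) := by
        rw [← zpow_add₀ qq_ne_zero]
        congr 1
        ring
      rw [h₁, h₂, two_mul, zpow_add₀ qq_ne_zero]
      ring
    rw [contraction, contractionRoots, Multiset.map_bind, Multiset.prod_bind]
    clear heval hcoe hP P
    induction s using Multiset.induction with
    | empty => simp
    | cons a s ih =>
      rw [Multiset.map_cons, Multiset.prod_cons, Multiset.map_cons, Multiset.prod_cons,
        Multiset.sum_cons, mul_add, zpow_add₀ qq_ne_zero, mul_mul_mul_comm, ih]
      congr 1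
      rw [Multiset.map_bind, Multiset.prod_bind]
      simp only [hroot, Multiset.prod_map_mul, Multiset.map_const', Multiset.prod_replicate,
        Multiset.insert_eq_cons, Multiset.map_cons, Multiset.map_singleton, Multiset.prod_cons,
        Multiset.prod_singleton, Function.comp_apply, Polynomial.eval_sub, Polynomial.eval_mul,
        Polynomial.eval_C, Polynomial.eval_X, Polynomial.eval_one, mul_one, ← zpow_natCast,
        ← zpow_mul]
      congr 2
      ring

/-- The normally ordered product of the operators `x(z qq^l)` for the multiset `s` of shifts `l`. -/
def vertexOp (s : Multiset ℤ) : OpSeries Scalars L₀ := fun n =>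
  Finsupp.lsum Scalars fun k : ℤ =>
    (Finsupp.lsingle (k + s.card) : Fock →ₗ[Scalars] L₀) ∘ₗ
      (qq ^ (2 * k * s.sum) •
        fockVertex (powerSum s) (powerSumInv s) (n - 2 * k * s.card))

theorem vertexOp_single (s : Multiset ℤ) (n k : ℤ) (f : Fock) :
    vertexOp s n (Finsupp.single k f) = Finsupp.single (k + s.card)
      (qq ^ (2 * k * s.sum) • fockVertex (powerSum s) (powerSumInv s) (n - 2 * k * s.card) f) := by
  rw [vertexOp, Finsupp.lsum_single]
  rfl

theorem normalOrdered_eq_vertexOp (s : Finset ℤ) : normalOrdered s = vertexOp s.val := by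
  have : s.val.sum = ∑ l ∈ s, l := by rw [Finset.sum, Multiset.map_id']
  funext n
  rw [vertexOp, this]
  rfl

theorem frenkelJing_eq_vertexOp : frenkelJing = vertexOp {0} := by
  have h₁ : powerSum {0} = fun _ => 1 := by
    funext r
    simp [powerSum]
  have h₂ : powerSumInv {0} = fun _ => 1 := by
    funext r
    simp [powerSumInv]
  funext n
  rw [vertexOp, h₁, h₂]
  simp only [Multiset.card_singleton, Multiset.sum_singleton, mul_zero, zpow_zero, one_smul,
    Nat.cast_one, mul_one]
  rfl

theorem opSeries_ext {a b : OpSeries Scalars L₀}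
    (h : ∀ n k f, a n (Finsupp.single k f) = b n (Finsupp.single k f)) : a = b :=
  funext fun n => Finsupp.lhom_ext fun k f => h n k f

theorem vertexOp_zero : vertexOp 0 = idSeries Scalars L₀ := by
  have h₁ : powerSum 0 = 0 := by
    funext r
    simp [powerSum]
  have h₂ : powerSumInv 0 = 0 := by
    funext r
    simp [powerSumInv]
  refine opSeries_ext fun n k f => ?_
  rw [vertexOp_single, h₁, h₂, fockVertex_zero]
  rcases eq_or_ne n 0 with rfl | hn
  · simp [idSeries]
  · simp [idSeries, hn]

theorem sum_map_add_one (s : Multiset ℤ) : (s.map (· + 1)).sum = s.sum + s.card := by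
  rw [Multiset.sum_map_add, Multiset.map_id']
  simp

theorem scale_vertexOp (s : Multiset ℤ) : scale qq (vertexOp s) = vertexOp (s.map (· + 1)) := by
  refine opSeries_ext fun n k f => ?_
  rw [vertexOp_single, fockVertex_powerSum_shift, scale, LinearMap.smul_apply, vertexOp_single,
    Multiset.card_map, Finsupp.smul_single, scale, LinearMap.smul_apply, smul_smul, smul_smul,
    ← zpow_add₀ qq_ne_zero, ← zpow_add₀ qq_ne_zero, sum_map_add_one]
  congr 3
  ring

theorem quasiCommutative_vertexOp (s t : Multiset ℤ) :
    QuasiCommutative (vertexOp s) (vertexOp t) := by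
  obtain ⟨K, hK, -⟩ := exists_contraction_bound s t
  intro v
  induction v using Finsupp.induction_linear with
  | zero => exact ⟨0, fun i j _ => by rw [map_zero, map_zero]⟩
  | add f g hf hg =>
    obtain ⟨N, hN⟩ := hf
    obtain ⟨N', hN'⟩ := hg
    exact ⟨min N N', fun i j hij => by
      rw [map_add, map_add, hN i j (by omega), hN' i j (by omega), add_zero]⟩
  | single k f =>
    obtain ⟨N, hN⟩ := quasiCommutative_fockVertex _ (powerSumInv s) _ (powerSumInv t) hK f
    refine ⟨N + min (2 * (k + t.card) * s.card) (2 * k * t.card), fun i j hij => ?_⟩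
    rw [vertexOp_single, vertexOp_single, map_smul, hN _ _ (by omega), smul_zero, smul_zero,
      Finsupp.single_zero]

/-- Normally ordered products multiply, up to a scalar and a power of `z`, by joining the multisets
of their shifts. -/
theorem vertexOp_mulSeries_vertexOp (s t : Multiset ℤ) :
    vertexOp s ⋆ vertexOp t =
      contraction s t • zMul (2 * s.card * t.card) (vertexOp (s + t)) := by
  obtain ⟨K, hK, hKsum⟩ := exists_contraction_bound s t
  refine opSeries_ext fun n k f => ?_
  set x : ℤ := 2 * (k + t.card) * s.card with hx
  set y : ℤ := 2 * k * t.card with hy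
  have hqc := (quasiCommutative_fockVertex (powerSum s) (powerSumInv s) (powerSum t)
    (powerSumInv t) hK).zMul_zMul x y
  set Φ : Fock →ₗ[Scalars] L₀ := (qq ^ (2 * (k + t.card) * s.sum) * qq ^ (2 * k * t.sum)) •
    Finsupp.lsingle (k + t.card + s.card) with hΦ
  have hterm : ∀ i : ℤ, vertexOp s i (vertexOp t (n - i) (Finsupp.single k f)) =
      Φ (zMul x (fockVertex (powerSum s) (powerSumInv s)) i
        (zMul y (fockVertex (powerSum t) (powerSumInv t)) (n - i) f)) := by
    intro i
    rw [vertexOp_single, vertexOp_single, map_smul, smul_smul, hΦ, LinearMap.smul_apply,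
      Finsupp.lsingle_apply, Finsupp.smul_single]
    rfl
  rw [mulSeries_apply (quasiCommutative_vertexOp s t), finsum_congr hterm,
    ← map_finsum Φ (hqc.finite_support n f), ← mulSeries_apply hqc,
    zMul_mulSeries_zMul (quasiCommutative_fockVertex _ _ _ _ hK),
    fockVertex_mulSeries_fockVertex _ _ _ _ hK, ← powerSum_add, ← powerSumInv_add, ← hKsum]
  simp only [Pi.smul_apply, LinearMap.smul_apply, zMul]
  rw [vertexOp_single, map_smul, hΦ, LinearMap.smul_apply, Finsupp.lsingle_apply,
    Finsupp.smul_single, Finsupp.smul_single, Finsupp.smul_single, smul_smul, smul_smul,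
    Multiset.card_add, Multiset.sum_add]
  have h₁ : n - 2 * s.card * t.card - 2 * k * (s.card + t.card : ℕ) = n - (x + y) := by
    rw [hx, hy]
    push_cast
    ring
  have h₂ : qq ^ (2 * (k + (t.card : ℤ)) * s.sum) * qq ^ (2 * k * t.sum) =
      qq ^ (2 * (t.card : ℤ) * s.sum) * qq ^ (2 * k * (s.sum + t.sum)) := by
    rw [← zpow_add₀ qq_ne_zero, ← zpow_add₀ qq_ne_zero]
    congr 1
    ring
  have h₃ : k + (t.card : ℤ) + s.card = k + (s.card + t.card : ℕ) := by
    push_cast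
    ring
  rw [h₁, h₂, h₃]
  congr 2
  ring

/-- The series `z ^ k :∏_{l ∈ s} x(z qq^l):`, for `(k, s)`. -/
def shiftedVertexOp (x : ℤ × Multiset ℤ) : OpSeries Scalars L₀ := zMul x.1 (vertexOp x.2)

/-- The span of all `z ^ k :∏_{l ∈ s} x(z qq^l):`. -/
def vertexSpan : Submodule Scalars (OpSeries Scalars L₀) :=
  Submodule.span Scalars (Set.range shiftedVertexOp)

theorem shiftedVertexOp_mem (x : ℤ × Multiset ℤ) : shiftedVertexOp x ∈ vertexSpan :=
  Submodule.subset_span ⟨x, rfl⟩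

theorem vertexOp_mem (s : Multiset ℤ) : vertexOp s ∈ vertexSpan := by
  simpa [shiftedVertexOp, zMul_zero] using shiftedVertexOp_mem (0, s)

theorem quasiCommutative_vertexSpan {a b : OpSeries Scalars L₀} (ha : a ∈ vertexSpan)
    (hb : b ∈ vertexSpan) : QuasiCommutative a b := by
  induction ha using Submodule.span_induction with
  | mem a ha =>
    obtain ⟨x, rfl⟩ := ha
    induction hb using Submodule.span_induction with
    | mem b hb =>
      obtain ⟨y, rfl⟩ := hb
      exact (quasiCommutative_vertexOp _ _).zMul_zMul _ _
    | zero => exact .zero_right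
    | add _ _ _ _ h₁ h₂ => exact h₁.add_right h₂
    | smul c _ _ h => exact h.smul_right c
  | zero => exact .zero_left
  | add _ _ _ _ h₁ h₂ => exact h₁.add_left h₂
  | smul c _ _ h => exact h.smul_left c

theorem shiftedVertexOp_mulSeries (x y : ℤ × Multiset ℤ) :
    shiftedVertexOp x ⋆ shiftedVertexOp y = contraction x.2 y.2 •
      shiftedVertexOp (x.1 + y.1 + 2 * x.2.card * y.2.card, x.2 + y.2) := by
  rw [shiftedVertexOp, shiftedVertexOp, zMul_mulSeries_zMul (quasiCommutative_vertexOp _ _),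
    vertexOp_mulSeries_vertexOp, shiftedVertexOp, zMul_smul, zMul_zMul_eq]

theorem mulSeries_mem_vertexSpan {a b : OpSeries Scalars L₀} (ha : a ∈ vertexSpan)
    (hb : b ∈ vertexSpan) : a ⋆ b ∈ vertexSpan := by
  induction ha using Submodule.span_induction with
  | mem a ha =>
    obtain ⟨x, rfl⟩ := ha
    induction hb using Submodule.span_induction with
    | mem b hb =>
      obtain ⟨y, rfl⟩ := hb
      rw [shiftedVertexOp_mulSeries]
      exact Submodule.smul_mem _ _ (shiftedVertexOp_mem _)
    | zero =>
      rw [mulSeries_zero]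
      exact Submodule.zero_mem _
    | add b b' hb hb' h₁ h₂ =>
      rw [mulSeries_add (quasiCommutative_vertexSpan (shiftedVertexOp_mem x) hb)
        (quasiCommutative_vertexSpan (shiftedVertexOp_mem x) hb')]
      exact Submodule.add_mem _ h₁ h₂
    | smul c b hb h =>
      rw [mulSeries_smul (quasiCommutative_vertexSpan (shiftedVertexOp_mem x) hb)]
      exact Submodule.smul_mem _ _ h
  | zero =>
    rw [zero_mulSeries]
    exact Submodule.zero_mem _
  | add a a' ha ha' h₁ h₂ =>
    rw [add_mulSeries (quasiCommutative_vertexSpan ha hb) (quasiCommutative_vertexSpan ha' hb)]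
    exact Submodule.add_mem _ h₁ h₂
  | smul c a ha h =>
    rw [smul_mulSeries (quasiCommutative_vertexSpan ha hb)]
    exact Submodule.smul_mem _ _ h

theorem zMul_mem_vertexSpan (k : ℤ) {a : OpSeries Scalars L₀} (ha : a ∈ vertexSpan) :
    zMul k a ∈ vertexSpan := by
  induction ha using Submodule.span_induction with
  | mem a ha =>
    obtain ⟨x, rfl⟩ := ha
    rw [shiftedVertexOp, zMul_zMul_eq]
    exact shiftedVertexOp_mem (k + x.1, x.2)
  | zero => exact Submodule.zero_mem _
  | add a b _ _ h₁ h₂ => exact Submodule.add_mem _ h₁ h₂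
  | smul c a _ h => exact Submodule.smul_mem _ c h

theorem scale_mem_vertexSpan {a : OpSeries Scalars L₀} (ha : a ∈ vertexSpan) :
    scale qq a ∈ vertexSpan := by
  induction ha using Submodule.span_induction with
  | mem a ha =>
    obtain ⟨x, rfl⟩ := ha
    rw [shiftedVertexOp, scale_zMul qq_ne_zero, scale_vertexOp]
    exact Submodule.smul_mem _ _ (zMul_mem_vertexSpan _ (vertexOp_mem _))
  | zero =>
    rw [scale_zero]
    exact Submodule.zero_mem _
  | add a b _ _ h₁ h₂ =>
    rw [scale_add]
    exact Submodule.add_mem _ h₁ h₂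
  | smul c a _ h =>
    rw [scale_smul]
    exact Submodule.smul_mem _ c h

/-- The multiplication of series is associative on the span, since the contraction is
multiplicative in both arguments. -/
theorem mulSeries_assoc_vertexSpan {a b c : OpSeries Scalars L₀} (ha : a ∈ vertexSpan)
    (hb : b ∈ vertexSpan) (hc : c ∈ vertexSpan) : a ⋆ b ⋆ c = a ⋆ (b ⋆ c) := by
  have hqc := @quasiCommutative_vertexSpan
  have hmul := @mulSeries_mem_vertexSpan
  induction ha using Submodule.span_induction with
  | mem a ha =>
    have ha' : a ∈ vertexSpan := Submodule.subset_span ha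
    induction hb using Submodule.span_induction with
    | mem b hb =>
      have hb' : b ∈ vertexSpan := Submodule.subset_span hb
      induction hc using Submodule.span_induction with
      | mem c hc =>
        obtain ⟨x, rfl⟩ := ha
        obtain ⟨y, rfl⟩ := hb
        obtain ⟨w, rfl⟩ := hc
        rw [shiftedVertexOp_mulSeries, shiftedVertexOp_mulSeries,
          smul_mulSeries (hqc (shiftedVertexOp_mem _) (shiftedVertexOp_mem _)),
          mulSeries_smul (hqc (shiftedVertexOp_mem _) (shiftedVertexOp_mem _)),
          shiftedVertexOp_mulSeries, shiftedVertexOp_mulSeries, smul_smul, smul_smul,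
          contraction_add_left, contraction_add_right, Multiset.card_add, Multiset.card_add]
        congr 1
        · ring
        · refine congrArg _ (Prod.ext ?_ (add_assoc _ _ _))
          push_cast
          ring
      | zero => simp only [mulSeries_zero]
      | add c c' hc hc' h₁ h₂ =>
        rw [mulSeries_add (hqc (hmul ha' hb') hc) (hqc (hmul ha' hb') hc'),
          mulSeries_add (hqc hb' hc) (hqc hb' hc'),
          mulSeries_add (hqc ha' (hmul hb' hc)) (hqc ha' (hmul hb' hc')), h₁, h₂]
      | smul k c hc h =>
        rw [mulSeries_smul (hqc (hmul ha' hb') hc), mulSeries_smul (hqc hb' hc),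
          mulSeries_smul (hqc ha' (hmul hb' hc)), h]
    | zero => simp only [mulSeries_zero, zero_mulSeries]
    | add b b' hb hb' h₁ h₂ =>
      rw [mulSeries_add (hqc ha' hb) (hqc ha' hb'),
        add_mulSeries (hqc (hmul ha' hb) hc) (hqc (hmul ha' hb') hc),
        add_mulSeries (hqc hb hc) (hqc hb' hc),
        mulSeries_add (hqc ha' (hmul hb hc)) (hqc ha' (hmul hb' hc)), h₁, h₂]
    | smul k b hb h =>
      rw [mulSeries_smul (hqc ha' hb), smul_mulSeries (hqc (hmul ha' hb) hc),
        smul_mulSeries (hqc hb hc), mulSeries_smul (hqc ha' (hmul hb hc)), h]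
  | zero => simp only [zero_mulSeries]
  | add a a' ha ha' h₁ h₂ =>
    rw [add_mulSeries (hqc ha hb) (hqc ha' hb),
      add_mulSeries (hqc (hmul ha hb) hc) (hqc (hmul ha' hb) hc),
      add_mulSeries (hqc ha (hmul hb hc)) (hqc ha' (hmul hb hc)), h₁, h₂]
  | smul k a ha h =>
    rw [smul_mulSeries (hqc ha hb), smul_mulSeries (hqc (hmul ha hb) hc),
      smul_mulSeries (hqc ha (hmul hb hc)), h]

theorem isFieldAlgebra_vertexSpan : IsFieldAlgebra qq vertexSpan := by
  have h1 : idSeries Scalars L₀ ∈ vertexSpan := by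
    rw [← vertexOp_zero]
    exact vertexOp_mem 0
  refine ⟨fun a ha v => ?_, h1, fun a ha b hb => quasiCommutative_vertexSpan ha hb,
    fun a ha => scale_mem_vertexSpan ha, fun a ha => ?_,
    fun a ha b hb => mulSeries_mem_vertexSpan ha hb,
    fun a ha b hb c hc => mulSeries_assoc_vertexSpan ha hb hc⟩
  · obtain ⟨N, hN⟩ := quasiCommutative_vertexSpan ha h1 v
    exact ⟨N, fun n hn => by simpa [idSeries] using hN n 0 (Or.inl hn)⟩
  · rw [qDeriv_eq]
    exact Submodule.smul_mem _ _ (Submodule.add_mem _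
      (zMul_mem_vertexSpan _ (scale_mem_vertexSpan ha))
      (Submodule.smul_mem _ _ (zMul_mem_vertexSpan _ ha)))

theorem isQVertexAlgebraOfFields_vertexSpan : IsQVertexAlgebraOfFields qq vertexSpan :=
  isFieldAlgebra_vertexSpan.isQVertexAlgebraOfFields notRootOfUnity_qq

theorem frenkelJing_mem_vertexSpan : frenkelJing ∈ vertexSpan := by
  rw [frenkelJing_eq_vertexOp]
  exact vertexOp_mem _

end VertexOp

/-! ### Linear independence of the normally ordered products -/

section Independence

open PowerSeries

theorem zpow_qq_injective : Function.Injective fun l : ℤ => qq ^ l := fun l m h => by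
  by_contra hlm
  refine notRootOfUnity_qq.zpow_ne_one (sub_ne_zero.2 hlm) ?_
  rw [zpow_sub₀ qq_ne_zero, show qq ^ l = qq ^ m from h, div_self (zpow_ne_zero _ qq_ne_zero)]

/-- A multiset of integers is determined by the power sums of positive degree; this is the
independence of the characters `r ↦ qq^{l r}`. -/
theorem eq_of_powerSum_eq {s t : Multiset ℤ} (h : ∀ r : ℕ+, powerSum s r = powerSum t r) :
    s = t := by
  set S := s.toFinset ∪ t.toFinset with hS
  have hcount : ∀ u : Multiset ℤ, u.toFinset ⊆ S → ∀ r : ℕ,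
      powerSum u r = ∑ l ∈ S, (u.count l : Scalars) * qq ^ (l * (r : ℤ)) := by
    intro u hu r
    rw [powerSum, Finset.sum_multiset_map_count]
    simp only [nsmul_eq_mul]
    refine Finset.sum_subset hu fun l _ hl => ?_
    rw [Multiset.count_eq_zero.2 fun h => hl (Multiset.mem_toFinset.2 h), Nat.cast_zero, zero_mul]
  have hli := (linearIndependent_monoidHom (Multiplicative ℕ) Scalars).comp
    (fun l : ℤ => powersHom Scalars (qq ^ l)) ((powersHom Scalars).injective.comp zpow_qq_injective)
  have hzero := linearIndependent_iff'.1 hli S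
    (fun l => ((s.count l : Scalars) - t.count l) * qq ^ l) ?_
  · refine Multiset.ext.2 fun l => ?_
    by_cases hl : l ∈ S
    · have := (mul_eq_zero.1 (hzero l hl)).resolve_right (zpow_ne_zero _ qq_ne_zero)
      exact_mod_cast sub_eq_zero.1 this
    · simp only [hS, Finset.mem_union, Multiset.mem_toFinset, not_or] at hl
      rw [Multiset.count_eq_zero.2 hl.1, Multiset.count_eq_zero.2 hl.2]
  · funext n
    have hr := h (Nat.succPNat n.toAdd)
    rw [hcount s Finset.subset_union_left, hcount t Finset.subset_union_right, ← sub_eq_zero,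
      ← Finset.sum_sub_distrib] at hr
    rw [Finset.sum_apply, Pi.zero_apply, ← hr]
    refine Finset.sum_congr rfl fun l _ => ?_
    simp only [Pi.smul_apply, Function.comp_apply, smul_eq_mul, powersHom_apply]
    rw [← sub_mul, mul_assoc, ← pow_succ', ← zpow_natCast, ← zpow_mul]
    rfl

/-- `∂_r E₋⁺(w) = E₋⁺(w) (∂_r + c w^r)` with a scalar `c`, so that `E₋⁺(w) 1` is an eigenvector of
the derivations, up to a shift of the powers of `w`. -/
theorem pderiv_expMinus_one (p : ℕ → Scalars) (r : ℕ+) (n : ℤ) :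
    MvPolynomial.pderiv r (expMinus p n 1) = (fjCoeff r * p r) • expMinus p (n - r) 1 := by
  have key : minusSeries p * C (MvPolynomial.pderiv r : Derivation Scalars Fock Fock).toLinearMap =
      (C (MvPolynomial.pderiv r : Derivation Scalars Fock Fock).toLinearMap +
        (-(fjCoeff r * p r)) • X ^ (r : ℕ)) * minusSeries p := by
    refine expSeries_mul_C Scalars (coeff_zero_minusExponent p) (coeffCommute_minusExponent p p)
      ?_ ?_ ?_
    · rw [coeff_smul, coeff_X_pow, if_neg r.ne_zero.symm, smul_zero]
    · intro i a
      rw [coeff_smul, coeff_X_pow]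
      split_ifs
      · exact (Commute.one_left a).smul_left _
      · rw [smul_zero]
        exact Commute.zero_left _
    · ext1 n
      rw [coeff_mul_C, map_add, coeff_C_mul, coeff_smul, coeff_X_pow]
      rcases n.eq_zero_or_pos with rfl | hn
      · rw [coeff_zero_minusExponent, if_neg r.ne_zero.symm]
        simp
      · obtain ⟨m, rfl⟩ : ∃ m : ℕ+, n = m := ⟨⟨n, hn⟩, rfl⟩
        refine LinearMap.ext fun f => ?_
        rw [coeff_minusExponent]
        simp only [LinearMap.smul_apply, Module.End.mul_apply, LinearMap.add_apply, creator_apply,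
          Derivation.coeFn_coe, Derivation.map_smul, MvPolynomial.pderiv_mul]
        by_cases h : m = r
        · subst h
          simp only [MvPolynomial.pderiv_X_self, if_true, Module.End.one_apply]
          rw [one_mul, smul_add, neg_smul]
          abel
        · rw [MvPolynomial.pderiv_X_of_ne h, if_neg fun h' => h (PNat.coe_inj.1 h')]
          simp
  rcases lt_or_ge n 0 with hn | hn
  · rw [expMinus_of_neg _ hn, expMinus_of_neg _ (by have := r.pos; omega), LinearMap.zero_apply,
      map_zero, smul_zero]
  lift n to ℕ using hn
  have h := LinearMap.congr_fun (congrArg (coeff n) key) 1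
  rw [coeff_mul_C, add_mul, map_add, coeff_C_mul, smul_mul_assoc, coeff_smul,
    coeff_X_pow_mul', Module.End.mul_apply, LinearMap.add_apply, Module.End.mul_apply,
    Derivation.coeFn_coe, Derivation.map_one_eq_zero, map_zero] at h
  rw [expMinus_natCast]
  split_ifs at h with hr
  · rw [← Nat.cast_sub hr, expMinus_natCast]
    rw [LinearMap.smul_apply, neg_smul] at h
    exact eq_of_sub_eq_zero ((sub_eq_add_neg _ _).trans h.symm)
  · rw [expMinus_of_neg _ (by omega), LinearMap.zero_apply, smul_zero]
    simpa using h.symm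

/-- The map `K(1) ⊗ ℂ{Q} → K(1)` that replaces the factors `e^{kα}` by `1`. -/
def forgetCharge : L₀ →ₗ[Scalars] Fock :=
  Finsupp.lsum Scalars fun _ => (LinearMap.id : Fock →ₗ[Scalars] Fock)

/-- The series `a(z) (1 ⊗ e^0)`, with the factors `e^k` in its coefficients replaced by `1`. -/
def vacuumSeries : OpSeries Scalars L₀ →ₗ[Scalars] ℤ → Fock where
  toFun a n := forgetCharge (a n (Finsupp.single 0 1))
  map_add' a b := by
    funext n
    simp only [Pi.add_apply, LinearMap.add_apply, map_add]
  map_smul' c a := by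
    funext n
    simp only [Pi.smul_apply, LinearMap.smul_apply, map_smul, RingHom.id_apply]

theorem vacuumSeries_shiftedVertexOp (x : ℤ × Multiset ℤ) :
    vacuumSeries (shiftedVertexOp x) = fun n => expMinus (powerSum x.2) (n - x.1) 1 := by
  funext n
  have hB : ∀ b : ℤ, ((1 : ℕ) : ℤ) ≤ b → expPlus (powerSumInv x.2) (-b) (1 : Fock) = 0 := by
    intro b hb
    lift b to ℕ using by omega
    rw [expPlus_neg_natCast, ← MvPolynomial.C_1]
    exact coeff_plusSeries_C _ (by omega) 1
  have h0 : expPlus (powerSumInv x.2) (-((0 : ℕ) : ℤ)) (1 : Fock) = 1 := by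
    rw [expPlus_neg_natCast, coeff_zero_plusSeries, Module.End.one_apply]
  change forgetCharge (vertexOp x.2 (n - x.1) (Finsupp.single 0 1)) = _
  rw [vertexOp_single, forgetCharge, Finsupp.lsum_single, LinearMap.id_apply,
    fockVertex_apply _ _ hB,
    Finset.sum_range_one, h0]
  simp

/-- The operators `u(z) ↦ z^{-r} ∂_r u(z)` on series with coefficients in the Fock space. -/
def shiftedPderiv (r : ℕ+) : Module.End Scalars (ℤ → Fock) where
  toFun u n := MvPolynomial.pderiv r (u (n + r))
  map_add' u v := by
    funext n
    simp only [Pi.add_apply, map_add]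
  map_smul' c u := by
    funext n
    simp only [Pi.smul_apply, Derivation.map_smul, RingHom.id_apply]

theorem commute_shiftedPderiv (r s : ℕ+) : Commute (shiftedPderiv r) (shiftedPderiv s) := by
  refine LinearMap.ext fun u => funext fun n => ?_
  change MvPolynomial.pderiv r (MvPolynomial.pderiv s (u (n + r + s))) =
    MvPolynomial.pderiv s (MvPolynomial.pderiv r (u (n + s + r)))
  rw [pderiv_comm, add_right_comm]

theorem shiftedPderiv_vacuumSeries (r : ℕ+) (x : ℤ × Multiset ℤ) :
    shiftedPderiv r (vacuumSeries (shiftedVertexOp x)) =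
      (fjCoeff r * powerSum x.2 r) • vacuumSeries (shiftedVertexOp x) := by
  rw [vacuumSeries_shiftedVertexOp]
  funext n
  change MvPolynomial.pderiv r (expMinus (powerSum x.2) (n + r - x.1) 1) =
    (fjCoeff r * powerSum x.2 r) • expMinus (powerSum x.2) (n - x.1) 1
  rw [pderiv_expMinus_one]
  congr 3
  ring

theorem fjCoeff_ne_zero (r : ℕ+) : fjCoeff r ≠ 0 :=
  div_ne_zero (zpow_ne_zero _ notRootOfUnity_sqrtq.1) (qIntSymm_ne_zero r.pos)

/-- The series `z ^ k :∏_{l ∈ s} x(z qq^l):` are linearly independent: applied to the vacuum they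
are joint eigenvectors of the operators `z^{-r} ∂_r`, with eigenvalues that determine `s`, and the
lowest power of `z` determines `k`. -/
theorem linearIndependent_shiftedVertexOp : LinearIndependent Scalars shiftedVertexOp := by
  classical
  refine LinearIndependent.of_comp vacuumSeries (linearIndependent_iff'.2 fun t g hg => ?_)
  set u : ℤ × Multiset ℤ → ℤ → Fock := vacuumSeries ∘ shiftedVertexOp with hu
  set χ : Multiset ℤ → ℕ+ → Scalars := fun s r => fjCoeff r * powerSum s r with hχ
  have hχinj : Function.Injective χ := fun s s' h => eq_of_powerSum_eq fun r =>
    mul_left_cancel₀ (fjCoeff_ne_zero r) (congrFun h r)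
  have hind := (Module.End.independent_iInf_maxGenEigenspace_of_forall_mapsTo shiftedPderiv
    fun r s φ => Module.End.mapsTo_maxGenEigenspace_of_comm (commute_shiftedPderiv s r) φ).comp
    hχinj
  have hmem : ∀ x, u x ∈ ⨅ r, (shiftedPderiv r).maxGenEigenspace (χ x.2 r) := fun x =>
    (Submodule.mem_iInf _).2 fun r => Module.End.eigenspace_le_maxGenEigenspace
      (Module.End.mem_eigenspace_iff.2 (shiftedPderiv_vacuumSeries r x))
  -- Joint eigenspaces are independent, so the terms with a common `s` already sum to zero.
  have hfib := (iSupIndep_iff_finsetSum_eq_zero_imp_eq_zero _).1 hind (t.image Prod.snd)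
    (fun s => ∑ x ∈ t with x.2 = s, g x • u x)
    (fun s _ => Submodule.sum_mem _ fun x hx => by
      have hxs := (Finset.mem_filter.1 hx).2
      subst hxs
      exact Submodule.smul_mem _ _ (hmem x))
    ((Finset.sum_fiberwise_of_maps_to (fun x hx => Finset.mem_image_of_mem _ hx) _).trans hg)
  by_contra! hne
  obtain ⟨x₀, hx₀, hgx₀⟩ := hne
  -- Among these terms, only the one with the least `k` contributes to the coefficient of `z ^ k`.
  obtain ⟨x₁, hx₁, hmin⟩ := Finset.exists_min_image
    (t.filter fun x => x.2 = x₀.2 ∧ g x ≠ 0) Prod.fst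
    ⟨x₀, Finset.mem_filter.2 ⟨hx₀, rfl, hgx₀⟩⟩
  obtain ⟨hx₁t, hx₁s, hgx₁⟩ := Finset.mem_filter.1 hx₁
  have h := congrFun (hfib x₀.2 (Finset.mem_image_of_mem _ hx₀)) x₁.1
  rw [Finset.sum_apply, Pi.zero_apply, Finset.sum_eq_single x₁] at h
  · simp only [Pi.smul_apply, hu, Function.comp_apply, vacuumSeries_shiftedVertexOp, sub_self] at h
    rw [← Nat.cast_zero, expMinus_natCast, minusSeries, coeff_zero_expSeries,
      Module.End.one_apply] at h
    exact hgx₁ ((smul_eq_zero.1 h).resolve_right one_ne_zero)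
  · intro x hx hxne
    obtain ⟨hxt, hxs⟩ := Finset.mem_filter.1 hx
    by_cases hgx : g x = 0
    · rw [hgx, zero_smul, Pi.zero_apply]
    · have hle := hmin x (Finset.mem_filter.2 ⟨hxt, hxs, hgx⟩)
      have hlt : x₁.1 < x.1 := lt_of_le_of_ne hle fun h =>
        hxne (Prod.ext h.symm (hxs.trans hx₁s.symm))
      simp only [Pi.smul_apply, hu, Function.comp_apply, vacuumSeries_shiftedVertexOp]
      rw [expMinus_of_neg _ (by omega), LinearMap.zero_apply, smul_zero]
  · intro h
    exact absurd (Finset.mem_filter.2 ⟨hx₁t, hx₁s⟩) h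

theorem linearIndependent_normalOrdered : LinearIndependent Scalars normalOrdered := by
  have h := linearIndependent_shiftedVertexOp.comp (fun s : Finset ℤ => ((0 : ℤ), s.val))
    fun s t h => Finset.val_injective (Prod.ext_iff.1 h).2
  convert h using 1
  funext s
  rw [Function.comp_apply, shiftedVertexOp, zMul_zero, normalOrdered_eq_vertexOp]

end Independence

/-! ### Leading terms of monomials -/

section LeadingTerms

local infixl:70 " ⋆ " => mulSeries

/-- A family whose members have distinct leading terms with respect to a linearly independent
family is linearly independent. -/
theorem linearIndependent_of_leading {K L ι κ : Type*} [Field K] [AddCommGroup L] [Module K L]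
    {e : κ → OpSeries K L} (he : LinearIndependent K e) (d : κ → ℤ) {v : ι → OpSeries K L}
    {lead : ι → κ}
    (hlead : Function.Injective lead) {c : ι → K} (hc : ∀ i, c i ≠ 0)
    (hv : ∀ i, ∃ r ∈ Submodule.span K (e '' {x | d (lead i) < d x}), v i = c i • e (lead i) + r) :
    LinearIndependent K v := by
  classical
  obtain ⟨φ, hφ⟩ := LinearMap.exists_leftInverse_of_injective
    (Finsupp.linearCombination K e) (LinearMap.ker_eq_bot.2 he)
  have hφe : ∀ x, φ (e x) = Finsupp.single x 1 := fun x => by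
    have := LinearMap.congr_fun hφ (Finsupp.single x 1)
    simpa using this
  -- The coordinate of `v i` at an index of degree at most `d (lead i)` comes from the leading term.
  have hcoeff : ∀ i x, d x ≤ d (lead i) →
      φ (v i) x = if lead i = x then c i else 0 := by
    intro i x hx
    obtain ⟨r, hr, hvi⟩ := hv i
    have hle : Submodule.span K (e '' {y | d (lead i) < d y}) ≤
        LinearMap.ker (Finsupp.lapply x ∘ₗ φ) := by
      rw [Submodule.span_le]
      rintro _ ⟨y, hy, rfl⟩
      have hyx : y ≠ x := by
        rintro rfl
        exact absurd hx (not_le.2 hy)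
      rw [SetLike.mem_coe, LinearMap.mem_ker, LinearMap.comp_apply, hφe, Finsupp.lapply_apply,
        Finsupp.single_eq_of_ne hyx.symm]
    have hr0 : φ r x = 0 := hle hr
    rw [hvi, map_add, map_smul, hφe, Finsupp.add_apply, hr0, add_zero, Finsupp.smul_apply,
      Finsupp.single_apply]
    split_ifs <;> simp
  refine linearIndependent_iff'.2 fun t g hg => ?_
  by_contra! hne
  obtain ⟨i₀, hi₀, hgi₀⟩ := hne
  -- A term of least degree in a relation cannot be cancelled.
  obtain ⟨i₁, hi₁, hmin⟩ := Finset.exists_min_image (t.filter fun i => g i ≠ 0)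
    (fun i => d (lead i)) ⟨i₀, Finset.mem_filter.2 ⟨hi₀, hgi₀⟩⟩
  obtain ⟨hi₁t, hgi₁⟩ := Finset.mem_filter.1 hi₁
  have h := congrArg (fun w => φ w (lead i₁)) hg
  simp only [map_sum, map_smul, map_zero, Finsupp.coe_zero, Pi.zero_apply,
    Finsupp.finsetSum_apply, Finsupp.smul_apply, smul_eq_mul] at h
  rw [Finset.sum_eq_single i₁] at h
  · rw [hcoeff i₁ _ le_rfl, if_pos rfl] at h
    exact (mul_ne_zero hgi₁ (hc i₁)) h
  · intro i hi hne
    by_cases hgi : g i = 0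
    · rw [hgi, zero_mul]
    · rw [hcoeff i _ (hmin i (Finset.mem_filter.2 ⟨hi, hgi⟩)), if_neg fun h => hne (hlead h),
        mul_zero]
  · exact fun h => absurd hi₁t h

/-- The span of the series `z ^ k :∏_{l ∈ s} x(z qq^l):` with `m` factors whose shifts have a sum
greater than `d`. -/
def higherTerms (m : ℕ) (d : ℤ) : Submodule Scalars (OpSeries Scalars L₀) :=
  Submodule.span Scalars (shiftedVertexOp '' {x | x.2.card = m ∧ d < x.2.sum})

theorem shiftedVertexOp_mem_higherTerms {x : ℤ × Multiset ℤ} {m : ℕ} {d : ℤ}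
    (hm : x.2.card = m) (hd : d < x.2.sum) : shiftedVertexOp x ∈ higherTerms m d :=
  Submodule.subset_span ⟨x, ⟨hm, hd⟩, rfl⟩

theorem higherTerms_le_vertexSpan (m : ℕ) (d : ℤ) : higherTerms m d ≤ vertexSpan :=
  Submodule.span_mono (Set.image_subset_range _ _)

/-- `z ^ k :∏_{l ∈ s} x(z qq^l):`, for `x = (k, s)`, is the leading term of `a(z)`: the other terms
have the same number of factors, and shifts with a larger sum. -/
def HasLeadingTerm (a : OpSeries Scalars L₀) (x : ℤ × Multiset ℤ) : Prop :=
  ∃ c : Scalars, c ≠ 0 ∧ ∃ r ∈ higherTerms x.2.card x.2.sum, a = c • shiftedVertexOp x + r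

/-- The effect of the substitution `z ↦ z qq` on the index of a series `z ^ k :∏ x(z qq^l):`. -/
def shiftIndex (x : ℤ × Multiset ℤ) : ℤ × Multiset ℤ := (x.1, x.2.map (· + 1))

theorem scale_shiftedVertexOp (x : ℤ × Multiset ℤ) :
    scale qq (shiftedVertexOp x) = qq ^ x.1 • shiftedVertexOp (shiftIndex x) := by
  rw [shiftedVertexOp, scale_zMul qq_ne_zero, scale_vertexOp]
  rfl

theorem qDeriv_shiftedVertexOp (x : ℤ × Multiset ℤ) :
    qDeriv qq (shiftedVertexOp x) = (qq - 1)⁻¹ •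
      (qq ^ x.1 • shiftedVertexOp (-1 + x.1, x.2.map (· + 1)) +
        (-1 : Scalars) • shiftedVertexOp (-1 + x.1, x.2)) := by
  rw [qDeriv_eq, scale_shiftedVertexOp, zMul_smul, shiftedVertexOp, shiftedVertexOp, zMul_zMul_eq,
    zMul_zMul_eq]
  rfl

theorem scale_mem_higherTerms {m : ℕ} {d : ℤ} {a : OpSeries Scalars L₀}
    (ha : a ∈ higherTerms m d) : scale qq a ∈ higherTerms m (d + m) := by
  induction ha using Submodule.span_induction with
  | mem a ha =>
    obtain ⟨x, ⟨hm, hd⟩, rfl⟩ := ha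
    rw [scale_shiftedVertexOp]
    refine Submodule.smul_mem _ _ (shiftedVertexOp_mem_higherTerms ?_ ?_)
    · rw [shiftIndex, Multiset.card_map, hm]
    · rw [shiftIndex, sum_map_add_one, hm]
      omega
  | zero => rw [scale_zero]; exact Submodule.zero_mem _
  | add a b _ _ h₁ h₂ => rw [scale_add]; exact Submodule.add_mem _ h₁ h₂
  | smul c a _ h => rw [scale_smul]; exact Submodule.smul_mem _ c h

theorem qDeriv_mem_higherTerms {m : ℕ} {d : ℤ} {a : OpSeries Scalars L₀}
    (ha : a ∈ higherTerms m d) : qDeriv qq a ∈ higherTerms m d := by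
  rw [← qDerivₗ_apply]
  induction ha using Submodule.span_induction with
  | mem a ha =>
    obtain ⟨x, ⟨hm, hd⟩, rfl⟩ := ha
    rw [qDerivₗ_apply, qDeriv_shiftedVertexOp]
    refine Submodule.smul_mem _ _ (Submodule.add_mem _ (Submodule.smul_mem _ _
      (shiftedVertexOp_mem_higherTerms ?_ ?_)) (Submodule.smul_mem _ _
      (shiftedVertexOp_mem_higherTerms hm hd)))
    · rw [Multiset.card_map, hm]
    · rw [sum_map_add_one]
      omega
  | zero => rw [map_zero]; exact Submodule.zero_mem _
  | add a b _ _ h₁ h₂ => rw [map_add]; exact Submodule.add_mem _ h₁ h₂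
  | smul c a _ h => rw [map_smul]; exact Submodule.smul_mem _ c h

theorem mulSeries_mem_higherTerms {m m' : ℕ} {d d' e : ℤ} {a b : OpSeries Scalars L₀}
    (ha : a ∈ Submodule.span Scalars (shiftedVertexOp '' {x | x.2.card = m ∧ d ≤ x.2.sum}))
    (hb : b ∈ Submodule.span Scalars (shiftedVertexOp '' {x | x.2.card = m' ∧ d' ≤ x.2.sum}))
    (he : e < d + d') : a ⋆ b ∈ higherTerms (m + m') e := by
  have hle : ∀ m (d : ℤ), Submodule.span Scalars
      (shiftedVertexOp '' {x | x.2.card = m ∧ d ≤ x.2.sum}) ≤ vertexSpan :=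
    fun m d => Submodule.span_mono (Set.image_subset_range _ _)
  induction ha using Submodule.span_induction with
  | mem a ha =>
    obtain ⟨x, ⟨hm, hd⟩, rfl⟩ := ha
    have hqc := fun b hb =>
      quasiCommutative_vertexSpan (shiftedVertexOp_mem x) (hle m' d' (x := b) hb)
    induction hb using Submodule.span_induction with
    | mem b hb =>
      obtain ⟨y, ⟨hm', hd'⟩, rfl⟩ := hb
      rw [shiftedVertexOp_mulSeries]
      refine Submodule.smul_mem _ _ (shiftedVertexOp_mem_higherTerms ?_ ?_)
      · rw [Multiset.card_add, hm, hm']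
      · rw [Multiset.sum_add]
        omega
    | zero => rw [mulSeries_zero]; exact Submodule.zero_mem _
    | add b b' hb hb' h₁ h₂ =>
      rw [mulSeries_add (hqc b hb) (hqc b' hb')]
      exact Submodule.add_mem _ h₁ h₂
    | smul c b hb h =>
      rw [mulSeries_smul (hqc b hb)]
      exact Submodule.smul_mem _ _ h
  | zero => rw [zero_mulSeries]; exact Submodule.zero_mem _
  | add a a' ha ha' h₁ h₂ =>
    rw [add_mulSeries (quasiCommutative_vertexSpan (hle _ _ ha) (hle _ _ hb))
      (quasiCommutative_vertexSpan (hle _ _ ha') (hle _ _ hb))]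
    exact Submodule.add_mem _ h₁ h₂
  | smul c a ha h =>
    rw [smul_mulSeries (quasiCommutative_vertexSpan (hle _ _ ha) (hle _ _ hb))]
    exact Submodule.smul_mem _ _ h

theorem higherTerms_eq (m : ℕ) (d : ℤ) : higherTerms m d = Submodule.span Scalars
    (shiftedVertexOp '' {x | x.2.card = m ∧ d + 1 ≤ x.2.sum}) := rfl

namespace HasLeadingTerm

variable {a b : OpSeries Scalars L₀} {x y : ℤ × Multiset ℤ}

theorem scale (h : HasLeadingTerm a x) : HasLeadingTerm (scale qq a) (shiftIndex x) := by
  obtain ⟨c, hc, r, hr, rfl⟩ := h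
  refine ⟨c * qq ^ x.1, mul_ne_zero hc (zpow_ne_zero _ qq_ne_zero), QVA.scale qq r, ?_, ?_⟩
  · rw [shiftIndex, sum_map_add_one, Multiset.card_map]
    exact scale_mem_higherTerms hr
  · rw [scale_add, scale_smul, scale_shiftedVertexOp, smul_smul]

theorem scale_pow (h : HasLeadingTerm a x) (n : ℕ) :
    HasLeadingTerm (QVA.scale (qq ^ n) a) (x.1, x.2.map (· + (n : ℤ))) := by
  induction n with
  | zero => simpa [scale_one] using h
  | succ n ih =>
    rw [pow_succ', ← scale_scale]
    convert ih.scale using 1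
    refine Prod.ext rfl ?_
    rw [shiftIndex, Multiset.map_map]
    refine Multiset.map_congr rfl fun l _ => ?_
    simp [add_assoc]

/-- The `q`-derivation only changes the power of `z` of a leading term: of the two terms
`a(z qq)` and `a(z)` of the difference quotient, the former has shifts with a larger sum. -/
theorem qDeriv (h : HasLeadingTerm a x) (hx : 0 < x.2.card) :
    HasLeadingTerm (qDeriv qq a) (-1 + x.1, x.2) := by
  obtain ⟨c, hc, r, hr, rfl⟩ := h
  have hq1 : (qq - 1)⁻¹ ≠ 0 := inv_ne_zero (sub_ne_zero.2 notRootOfUnity_qq.ne_one)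
  have h₂ : shiftedVertexOp (-1 + x.1, x.2.map (· + 1)) ∈ higherTerms x.2.card x.2.sum := by
    refine shiftedVertexOp_mem_higherTerms (Multiset.card_map _ _) ?_
    rw [sum_map_add_one]
    omega
  refine ⟨-(c * (qq - 1)⁻¹), neg_ne_zero.2 (mul_ne_zero hc hq1), _, Submodule.add_mem _
    (Submodule.smul_mem _ (c * (qq - 1)⁻¹ * qq ^ x.1) h₂) (qDeriv_mem_higherTerms hr), ?_⟩
  rw [← qDerivₗ_apply, map_add, map_smul, qDerivₗ_apply, qDerivₗ_apply, qDeriv_shiftedVertexOp,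
    smul_smul c, smul_add, smul_smul, smul_smul, mul_neg_one, ← add_assoc,
    add_comm (-(c * (qq - 1)⁻¹) • _)]

theorem qDivDeriv (h : HasLeadingTerm a x) (hx : 0 < x.2.card) (n : ℕ) :
    HasLeadingTerm (qDivDeriv qq n a) (-n + x.1, x.2) := by
  have key : HasLeadingTerm ((qDerivₗ qq ^ n) a) (-n + x.1, x.2) := by
    induction n with
    | zero => simpa using h
    | succ n ih =>
      rw [pow_succ', Module.End.mul_apply]
      have e : (-((n + 1 : ℕ) : ℤ) + x.1, x.2) = (-1 + (-(n : ℤ) + x.1), x.2) := by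
        congr 1
        push_cast
        ring
      rw [e]
      exact ih.qDeriv hx
  obtain ⟨c, hc, r, hr, he⟩ := key
  refine ⟨(qFact qq n)⁻¹ * c, mul_ne_zero (inv_ne_zero (qFact_ne_zero notRootOfUnity_qq n)) hc, _,
    Submodule.smul_mem _ (qFact qq n)⁻¹ hr, ?_⟩
  rw [QVA.qDivDeriv, he, smul_add, smul_smul]

/-- Leading terms multiply, unless their contraction vanishes. -/
theorem mul (ha : HasLeadingTerm a x) (hb : HasLeadingTerm b y)
    (h : contraction x.2 y.2 ≠ 0) :
    HasLeadingTerm (a ⋆ b) (x.1 + y.1 + 2 * x.2.card * y.2.card, x.2 + y.2) := by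
  obtain ⟨c, hc, r, hr, rfl⟩ := ha
  obtain ⟨c', hc', r', hr', rfl⟩ := hb
  have hle := higherTerms_le_vertexSpan
  have hcx := Submodule.smul_mem _ c (shiftedVertexOp_mem x)
  have hcy := Submodule.smul_mem _ c' (shiftedVertexOp_mem y)
  have hqc := @quasiCommutative_vertexSpan
  have hself : ∀ x : ℤ × Multiset ℤ, ∀ c : Scalars, c • shiftedVertexOp x ∈
      Submodule.span Scalars (shiftedVertexOp '' {y | y.2.card = x.2.card ∧ x.2.sum ≤ y.2.sum}) :=
    fun x c => Submodule.smul_mem _ _ (Submodule.subset_span ⟨x, ⟨rfl, le_rfl⟩, rfl⟩)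
  rw [add_mulSeries (hqc hcx (Submodule.add_mem _ hcy (hle _ _ hr')))
    (hqc (hle _ _ hr) (Submodule.add_mem _ hcy (hle _ _ hr'))),
    mulSeries_add (hqc hcx hcy) (hqc hcx (hle _ _ hr')),
    smul_mulSeries (hqc (shiftedVertexOp_mem x) hcy),
    mulSeries_smul (hqc (shiftedVertexOp_mem x) (shiftedVertexOp_mem y)),
    shiftedVertexOp_mulSeries, smul_smul, smul_smul, add_assoc]
  refine ⟨c * c' * contraction x.2 y.2, mul_ne_zero (mul_ne_zero hc hc') h, _, ?_, rfl⟩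
  simp only [Multiset.card_add, Multiset.sum_add]
  refine Submodule.add_mem _ ?_ ?_
  · rw [higherTerms_eq] at hr'
    exact mulSeries_mem_higherTerms (hself x c) hr' (by omega)
  · refine mulSeries_mem_higherTerms (d := x.2.sum + 1) (d' := y.2.sum) hr ?_ (by omega)
    refine Submodule.add_mem _ (hself y c') (Submodule.span_mono (Set.image_mono ?_) hr')
    exact fun z hz => ⟨hz.1, hz.2.le⟩

end HasLeadingTerm

/-- The index of the leading term of the monomial `x(z)_{l_m} ⋯ x(z)_{l_1} 1`. With `n = -l - 1`,
its shifts are `0, n_m, n_m + n_{m-1}, …, n_m + ⋯ + n_2`. -/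
def leadingIndex : List ℤ → ℤ × Multiset ℤ
  | [] => (0, 0)
  | r :: l => (-((-r - 1).toNat : ℤ) + (leadingIndex l).1 + 2 * (leadingIndex l).2.card,
      {0} + (leadingIndex l).2.map (· + ((-r - 1).toNat : ℤ)))

theorem Admissible.tail {r : ℤ} {l : List ℤ} (h : Admissible (r :: l)) : Admissible l := by
  refine ⟨fun k hk => h.1 k (List.mem_cons_of_mem _ hk), fun k hk => ?_⟩
  rcases l with - | ⟨r', l⟩
  · simp at hk
  · exact h.2 k (by rw [List.dropLast_cons_cons]; exact List.mem_cons_of_mem _ hk)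

theorem Admissible.head_le {r : ℤ} {l : List ℤ} (h : Admissible (r :: l)) (hl : l ≠ []) :
    r ≤ -3 := by
  rcases l with - | ⟨r', l⟩
  · exact absurd rfl hl
  · exact h.2 r (by rw [List.dropLast_cons_cons]; exact List.mem_cons_self)

theorem admissible_cons {r : ℤ} {l : List ℤ} (hr : r ≤ -3) (h : Admissible l) :
    Admissible (r :: l) := by
  refine ⟨fun k hk => ?_, fun k hk => ?_⟩
  · rcases List.mem_cons.1 hk with rfl | hk
    · omega
    · exact h.1 k hk
  · rcases l with - | ⟨r', l⟩
    · simp at hk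
    · rw [List.dropLast_cons_cons] at hk
      rcases List.mem_cons.1 hk with rfl | hk
      · exact hr
      · exact h.2 k hk

theorem leadingIndex_nonneg (l : List ℤ) : ∀ b ∈ (leadingIndex l).2, 0 ≤ b := by
  induction l with
  | nil => simp [leadingIndex]
  | cons r l ih =>
    intro b hb
    rw [leadingIndex, Multiset.mem_add, Multiset.mem_singleton, Multiset.mem_map] at hb
    rcases hb with rfl | ⟨b', hb', rfl⟩
    · exact le_rfl
    · have := ih b' hb'
      omega

theorem card_leadingIndex (l : List ℤ) : (leadingIndex l).2.card = l.length := by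
  induction l with
  | nil => rfl
  | cons r l ih =>
    rw [leadingIndex, Multiset.card_add, Multiset.card_map, ih, Multiset.card_singleton,
      List.length_cons, add_comm]

/-- An admissible list can be read off from its leading index: the head from the least shift that
is not the one of the new factor, or from the power of `z` if there is only one factor. -/
theorem leadingIndex_injective {l l' : List ℤ} (hl : Admissible l) (hl' : Admissible l')
    (h : leadingIndex l = leadingIndex l') : l = l' := by
  induction l generalizing l' with
  | nil =>
    have := congrArg (fun x => x.2.card) h
    simp only [card_leadingIndex, List.length_nil] at this
    exact (List.eq_nil_of_length_eq_zero this.symm).symm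
  | cons r l ih =>
    rcases l' with - | ⟨r', l'⟩
    · have := congrArg (fun x => x.2.card) h
      simp [card_leadingIndex] at this
    have hr := hl.1 r List.mem_cons_self
    have hr' := hl'.1 r' List.mem_cons_self
    have hlen := congrArg (fun x => x.2.card) h
    simp only [card_leadingIndex, List.length_cons, Nat.add_right_cancel_iff] at hlen
    have h₁ := congrArg Prod.fst h
    have h₂ := congrArg Prod.snd h
    simp only [leadingIndex, card_leadingIndex, hlen] at h₁ h₂
    have h₂ := add_left_cancel h₂
    -- The least element of the multiset of shifts determines the head of a list of length two or
    -- more; the head of a list with one element is determined by the power of `z`.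
    have hle : ∀ (r r' : ℤ) (l l' : List ℤ), l ≠ [] → (leadingIndex l).2.map
        (· + ((-r - 1).toNat : ℤ)) = (leadingIndex l').2.map (· + ((-r' - 1).toNat : ℤ)) →
        (-r' - 1).toNat ≤ (-r - 1).toNat := by
      intro r r' l l' hne h
      have h0 : (0 : ℤ) ∈ (leadingIndex l).2 := by
        rcases l with - | ⟨r₂, l⟩
        · exact absurd rfl hne
        · simp [leadingIndex]
      have hmem := Multiset.mem_map_of_mem (· + ((-r - 1).toNat : ℤ)) h0
      rw [h, Multiset.mem_map] at hmem
      obtain ⟨b, hb, hbr⟩ := hmem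
      have := leadingIndex_nonneg l' b hb
      omega
    rcases eq_or_ne l [] with rfl | hne
    · obtain rfl : l' = [] := List.eq_nil_of_length_eq_zero hlen.symm
      have : r = r' := by
        simp only [leadingIndex] at h₁
        omega
      rw [this]
    · have hne' : l' ≠ [] := by
        rintro rfl
        exact hne (List.eq_nil_of_length_eq_zero hlen)
      have e := le_antisymm (hle r' r l' l hne' h₂.symm) (hle r r' l l' hne h₂)
      have hrr : r = r' := by omega
      subst hrr
      rw [ih hl.tail hl'.tail (Prod.ext (by omega)
        (Multiset.map_injective (add_left_injective _) h₂))]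

theorem monomial_cons (r : ℤ) (l : List ℤ) :
    monomial qq frenkelJing (r :: l) = rProd qq frenkelJing r (monomial qq frenkelJing l) := rfl

theorem monomial_mem_vertexSpan (l : List ℤ) : monomial qq frenkelJing l ∈ vertexSpan := by
  induction l with
  | nil => exact isFieldAlgebra_vertexSpan.one_mem
  | cons r l ih => exact isFieldAlgebra_vertexSpan.rProd_mem frenkelJing_mem_vertexSpan ih r

/-- The contraction of `x(z)` with a normally ordered product vanishes only for the shifts `0`
and `1`. This is the reason for the bound `-3` on the indices of admissible monomials. -/
theorem contraction_zero_ne_zero {s : Multiset ℤ} (hs : ∀ b ∈ s, 2 ≤ b) :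
    contraction {0} s ≠ 0 := by
  rw [contraction, Multiset.map_singleton, Multiset.prod_singleton, Ne, Multiset.prod_eq_zero_iff,
    Multiset.mem_map, not_exists]
  rintro b ⟨hb, h⟩
  have hb2 := hs b hb
  rcases mul_eq_zero.1 h with h | h <;>
    · have := zpow_qq_injective (sub_eq_zero.1 h)
      omega

theorem hasLeadingTerm_frenkelJing : HasLeadingTerm frenkelJing (0, {0}) :=
  ⟨1, one_ne_zero, 0, Submodule.zero_mem _, by
    rw [frenkelJing_eq_vertexOp, shiftedVertexOp, zMul_zero, one_smul, add_zero]⟩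

theorem hasLeadingTerm_monomial {l : List ℤ} (hl : Admissible l) :
    HasLeadingTerm (monomial qq frenkelJing l) (leadingIndex l) := by
  induction l with
  | nil =>
    refine ⟨1, one_ne_zero, 0, Submodule.zero_mem _, ?_⟩
    rw [leadingIndex, shiftedVertexOp, zMul_zero, one_smul, vertexOp_zero, monomial,
      List.foldr_nil, add_zero]
  | cons r l ih =>
    have hr := hl.1 r List.mem_cons_self
    have h := (hasLeadingTerm_frenkelJing.qDivDeriv (by simp) (-r - 1).toNat).mul
      ((ih hl.tail).scale_pow (-r - 1).toNat) (contraction_zero_ne_zero fun b hb => ?_)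
    · rw [monomial_cons, isFieldAlgebra_vertexSpan.rProd_eq frenkelJing_mem_vertexSpan
        (monomial_mem_vertexSpan l) (n := (-r - 1).toNat) (by omega), leadingIndex]
      simpa using h
    · obtain ⟨b', hb', rfl⟩ := Multiset.mem_map.1 hb
      have hne : l ≠ [] := by
        rintro rfl
        simp [leadingIndex] at hb'
      have := hl.head_le hne
      have := leadingIndex_nonneg l b' hb'
      omega

theorem linearIndependent_monomial : LinearIndependent Scalars
    fun l : {l : List ℤ // Admissible l} => monomial qq frenkelJing l := by
  have h : ∀ l : {l : List ℤ // Admissible l}, ∃ c : Scalars, c ≠ 0 ∧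
      ∃ r ∈ higherTerms (leadingIndex l).2.card (leadingIndex l).2.sum,
        monomial qq frenkelJing l = c • shiftedVertexOp (leadingIndex l) + r :=
    fun l => hasLeadingTerm_monomial l.2
  choose c hc r hr he using h
  have hinj : Function.Injective fun l : {l : List ℤ // Admissible l} => leadingIndex l :=
    fun l l' h => Subtype.ext (leadingIndex_injective l.2 l'.2 h)
  have hr' : ∀ l : {l : List ℤ // Admissible l}, r l ∈ Submodule.span Scalars
      (shiftedVertexOp '' {x | (leadingIndex l).2.sum < x.2.sum}) := fun l =>
    Submodule.span_mono (Set.image_mono fun x hx => hx.2) (hr l)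
  exact linearIndependent_of_leading linearIndependent_shiftedVertexOp (fun x => x.2.sum) hinj hc
    fun l => ⟨r l, hr' l, he l⟩

end LeadingTerms

/-! ### Spanning -/

section Spanning

/-- The span of the admissible monomials with `m` factors. -/
def admissibleSpan (m : ℕ) : Submodule Scalars (OpSeries Scalars L₀) :=
  Submodule.span Scalars
    {a | ∃ l : List ℤ, Admissible l ∧ l.length = m ∧ a = monomial qq frenkelJing l}

theorem admissibleSpan_le_vertexSpan (m : ℕ) : admissibleSpan m ≤ vertexSpan := by
  rw [admissibleSpan, Submodule.span_le]
  rintro _ ⟨l, -, -, rfl⟩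
  exact monomial_mem_vertexSpan l

theorem rProd_mem_admissibleSpan {r : ℤ} (hr : r ≤ -3) {m : ℕ} {b : OpSeries Scalars L₀}
    (hb : b ∈ admissibleSpan m) : rProd qq frenkelJing r b ∈ admissibleSpan (m + 1) := by
  have hV := isQVertexAlgebraOfFields_vertexSpan.2
  have h0 := isFieldAlgebra_vertexSpan.rProd_zero_right frenkelJing_mem_vertexSpan r
  induction hb using Submodule.span_induction with
  | mem b hb =>
    obtain ⟨l, hl, hm, rfl⟩ := hb
    exact Submodule.subset_span ⟨r :: l, admissible_cons hr hl, by simp [hm], rfl⟩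
  | zero => rw [h0]; exact Submodule.zero_mem _
  | add b b' hb hb' h₁ h₂ =>
    have := hV.linear_right _ frenkelJing_mem_vertexSpan b (admissibleSpan_le_vertexSpan m hb) b'
      (admissibleSpan_le_vertexSpan m hb') 1 r
    rw [one_smul, one_smul] at this
    rw [this]
    exact Submodule.add_mem _ h₁ h₂
  | smul c b hb h =>
    have := hV.linear_right _ frenkelJing_mem_vertexSpan b (admissibleSpan_le_vertexSpan m hb) 0
      (Submodule.zero_mem _) c r
    rw [h0, add_zero, add_zero] at this
    rw [this]
    exact Submodule.smul_mem _ c h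

/-- The contraction of the shift `0` with itself vanishes. -/
theorem frenkelJing_rProd_neg_one : rProd qq frenkelJing (-1) frenkelJing = 0 := by
  rw [isFieldAlgebra_vertexSpan.rProd_eq frenkelJing_mem_vertexSpan frenkelJing_mem_vertexSpan
    (n := 0) (by norm_num), qDivDeriv_zero, pow_zero, scale_one, frenkelJing_eq_vertexOp,
    vertexOp_mulSeries_vertexOp]
  simp [contraction]

/-- The contractions of the shifts `0` and `1` with the shift `1` vanish. -/
theorem frenkelJing_rProd_neg_two : rProd qq frenkelJing (-2) frenkelJing = 0 := by
  have hx : frenkelJing = shiftedVertexOp (0, {0}) := by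
    rw [frenkelJing_eq_vertexOp, shiftedVertexOp, zMul_zero]
  have hqc := @quasiCommutative_vertexSpan
  have hE := shiftedVertexOp_mem
  rw [isFieldAlgebra_vertexSpan.rProd_eq frenkelJing_mem_vertexSpan frenkelJing_mem_vertexSpan
    (n := 1) (by norm_num), qDivDeriv, pow_one, pow_one, qDerivₗ_apply, hx,
    qDeriv_shiftedVertexOp, scale_shiftedVertexOp, smul_smul,
    smul_mulSeries (hqc (Submodule.add_mem _ (Submodule.smul_mem _ _ (hE _))
      (Submodule.smul_mem _ _ (hE _))) (Submodule.smul_mem _ _ (hE _))),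
    add_mulSeries (hqc (Submodule.smul_mem _ _ (hE _)) (Submodule.smul_mem _ _ (hE _)))
      (hqc (Submodule.smul_mem _ _ (hE _)) (Submodule.smul_mem _ _ (hE _))),
    smul_mulSeries (hqc (hE _) (Submodule.smul_mem _ _ (hE _))),
    smul_mulSeries (hqc (hE _) (Submodule.smul_mem _ _ (hE _))),
    mulSeries_smul (hqc (hE _) (hE _)), mulSeries_smul (hqc (hE _) (hE _)),
    shiftedVertexOp_mulSeries, shiftedVertexOp_mulSeries]
  simp [contraction, shiftIndex]

theorem mem_of_sum_eq_zero {F L : Type*} [Field F] [AddCommGroup L] [Module F L]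
    (W : Submodule F (OpSeries F L)) {n : ℕ} {c : ℕ → F} {v : ℕ → OpSeries F L} (hc : c 0 ≠ 0)
    (h : ∑ l ∈ Finset.range (n + 1), c l • v l = 0)
    (hv : ∀ l < n, v (l + 1) ∈ W) : v 0 ∈ W := by
  rw [Finset.sum_range_succ', add_comm] at h
  have h' : c 0 • v 0 = -∑ k ∈ Finset.range n, c (k + 1) • v (k + 1) :=
    eq_neg_of_add_eq_zero_left h
  rw [← W.smul_mem_iff hc, h']
  exact W.neg_mem (W.sum_mem fun l hl => W.smul_mem _ (hv l (Finset.mem_range.1 hl)))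

/-- The relations `x(z)_{-1} x(z) = 0` and `x(z)_{-2} x(z) = 0` and the associativity rewrite every
monomial as a combination of admissible ones. -/
theorem monomial_mem_admissibleSpan {l : List ℤ} (hl : ∀ k ∈ l, k ≤ -1) :
    monomial qq frenkelJing l ∈ admissibleSpan l.length := by
  induction hn : l.length generalizing l with
  | zero =>
    obtain rfl := List.eq_nil_of_length_eq_zero hn
    exact Submodule.subset_span ⟨[], ⟨by simp, by simp⟩, rfl, rfl⟩
  | succ n ih =>
    obtain _ | ⟨r, l⟩ := l
    · simp at hn
    have hn : l.length = n := by simpa using hn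
    have hr := hl r List.mem_cons_self
    obtain _ | ⟨r', l⟩ := l
    · subst hn
      exact Submodule.subset_span ⟨[r], ⟨by simpa using hr, by simp⟩, rfl, rfl⟩
    have hr' := hl r' (by simp)
    have hl' : ∀ k ∈ l, k ≤ -1 := fun k hk => hl k (by simp [hk])
    set x := frenkelJing with hx
    have hxV : x ∈ vertexSpan := frenkelJing_mem_vertexSpan
    -- An outer index at most `-3` is admissible whatever the inner ones are.
    have hlow : ∀ s s' : ℤ, s ≤ -3 → s' ≤ -1 →
        rProd qq x s (rProd qq x s' (monomial qq x l)) ∈ admissibleSpan (n + 1) := by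
      intro s s' hs hs'
      refine rProd_mem_admissibleSpan hs (ih (l := s' :: l) ?_ (by simpa using hn))
      intro k hk
      rcases List.mem_cons.1 hk with rfl | hk
      · exact hs'
      · exact hl' k hk
    have hassoc := fun i j => isFieldAlgebra_vertexSpan.sum_rProd_rProd notRootOfUnity_qq hxV hxV
      (monomial_mem_vertexSpan l) i j
    have hzero : ∀ (r : ℤ) (c : OpSeries Scalars L₀), r < 0 →
        rProd qq (0 : OpSeries Scalars L₀) r c = 0 := by
      intro r c hr
      rw [rProd, if_neg (by omega), qDeriv_iterate, map_zero, zero_mulSeries, smul_zero]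
    -- The associativity for `(x_{-2} x)_{-j-1} = 0` and for `(x_{-1} x)_{-j-1} = 0` expresses the
    -- products with outer index `-2` and `-1` by those with a smaller outer index.
    have htwo : ∀ j : ℕ, rProd qq x (-2) (rProd qq x (-(j : ℤ) - 1) (monomial qq x l)) ∈
        admissibleSpan (n + 1) := by
      intro j
      have h := hassoc 1 j
      rw [show (-((1 : ℕ) : ℤ) - 1) = -2 by norm_num, frenkelJing_rProd_neg_two,
        hzero _ _ (by omega)] at h
      have := mem_of_sum_eq_zero (admissibleSpan (n + 1)) ?_ h fun m _ =>
        hlow _ _ (by push_cast; omega) (by omega)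
      · simpa using this
      · rw [qBinom_zero_right, mul_one]
        exact pow_ne_zero _ qq_ne_zero
    have hone : ∀ j : ℕ, rProd qq x (-1) (rProd qq x (-(j : ℤ) - 1) (monomial qq x l)) ∈
        admissibleSpan (n + 1) := by
      intro j
      have h := hassoc 0 j
      rw [show (-((0 : ℕ) : ℤ) - 1) = -1 by norm_num, frenkelJing_rProd_neg_one,
        hzero _ _ (by omega)] at h
      have := mem_of_sum_eq_zero (admissibleSpan (n + 1)) ?_ h fun m _ => ?_
      · simpa using this
      · rw [qBinom_zero_right, mul_one]
        exact pow_ne_zero _ qq_ne_zero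
      · rcases m.eq_zero_or_pos with rfl | hm
        · exact htwo (j - 1)
        · exact hlow _ _ (by push_cast; omega) (by omega)
    obtain ⟨j, rfl⟩ : ∃ j : ℕ, r' = -j - 1 := ⟨(-r' - 1).toNat, by omega⟩
    rcases (by omega : r = -1 ∨ r = -2 ∨ r ≤ -3) with rfl | rfl | hr3
    · exact hone j
    · exact htwo j
    · exact hlow r _ hr3 hr'

theorem W₀_eq_span : W₀ = Submodule.span Scalars
    (Set.range fun l : {l : List ℤ // Admissible l} => monomial qq frenkelJing l) := by
  refine le_antisymm (Submodule.span_le.2 ?_) (Submodule.span_le.2 ?_)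
  · rintro _ ⟨l, hl, rfl⟩
    refine Submodule.span_mono ?_ (monomial_mem_admissibleSpan hl)
    rintro _ ⟨l', hl', -, rfl⟩
    exact ⟨⟨l', hl'⟩, rfl⟩
  · rintro _ ⟨l, rfl⟩
    exact Submodule.subset_span ⟨l, l.2.1, rfl⟩

/-- The admissible monomials, as a basis of `W₀`. -/
def admissibleBasis : Module.Basis {l : List ℤ // Admissible l} Scalars W₀ :=
  (Module.Basis.span linearIndependent_monomial).map (LinearEquiv.ofEq _ _ W₀_eq_span.symm)

theorem admissibleBasis_apply (l : {l : List ℤ // Admissible l}) :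
    (admissibleBasis l : OpSeries Scalars L₀) = monomial qq frenkelJing l := by
  rw [admissibleBasis, Module.Basis.map_apply, LinearEquiv.coe_ofEq_apply]
  exact congrArg Subtype.val (Module.Basis.span_apply linearIndependent_monomial l)

end Spanning

/-! ### The generated nonlocal vertex algebra -/

section Generated

variable {F : Type*} [Field F] {L : Type*} [AddCommGroup L] [Module F L]

/-- Nonlocal `q`-vertex algebras of fields are stable under nonempty intersections. -/
theorem isLeast_generated {q : F} {S : Set (OpSeries F L)}
    (h : ∃ V : Submodule F (OpSeries F L), S ⊆ V ∧ IsQVertexAlgebraOfFields q V) :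
    IsLeast {V : Submodule F (OpSeries F L) | S ⊆ V ∧ IsQVertexAlgebraOfFields q V}
      (generated q S) := by
  obtain ⟨V, hSV, hV⟩ := h
  have hle : generated q S ≤ V := sInf_le ⟨hSV, hV⟩
  refine ⟨⟨fun a ha => ?_, fun a ha b hb => hV.1 a (hle ha) b (hle hb), ?_⟩, fun W hW => sInf_le hW⟩
  · exact (Submodule.mem_sInf).2 fun W hW => hW.1 ha
  · have hV := hV.2
    exact {
      le_fieldSpace := hle.trans hV.le_fieldSpace
      vacuum_mem := (Submodule.mem_sInf).2 fun W hW => hW.2.2.vacuum_mem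
      closed := fun a ha b hb r => (Submodule.mem_sInf).2 fun W hW =>
        hW.2.2.closed a (sInf_le hW ha) b (sInf_le hW hb) r
      linear_left := fun a ha a' ha' b hb => hV.linear_left a (hle ha) a' (hle ha') b (hle hb)
      linear_right := fun a ha b hb b' hb' => hV.linear_right a (hle ha) b (hle hb) b' (hle hb')
      truncation := fun a ha b hb => hV.truncation a (hle ha) b (hle hb)
      vacuum := fun b hb => hV.vacuum b (hle hb)
      creation := fun a ha => hV.creation a (hle ha)
      assoc := fun a ha b hb c hc => hV.assoc a (hle ha) b (hle hb) c (hle hc) }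

theorem isLeast_xAlgebra : IsLeast {V : Submodule Scalars (OpSeries Scalars L₀) |
    {frenkelJing} ⊆ (V : Set (OpSeries Scalars L₀)) ∧ IsQVertexAlgebraOfFields qq V} xAlgebra :=
  isLeast_generated ⟨vertexSpan, Set.singleton_subset_iff.2 frenkelJing_mem_vertexSpan,
    isQVertexAlgebraOfFields_vertexSpan⟩

theorem W₀_le_xAlgebra : W₀ ≤ xAlgebra := by
  obtain ⟨hx, hV⟩ := isLeast_xAlgebra.1
  refine Submodule.span_le.2 ?_
  rintro _ ⟨l, -, rfl⟩
  induction l with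
  | nil => exact hV.2.vacuum_mem
  | cons r l ih => exact hV.2.closed _ (Set.singleton_subset_iff.1 hx) _ ih r

end Generated

end QVA

end

theorem mainTheorem4 :
    -- the nonlocal vertex algebra generated by the Frenkel-Jing operator, and its subspace
    IsLeast {V : Submodule QVA.Scalars (QVA.OpSeries QVA.Scalars QVA.L₀) |
        {QVA.frenkelJing} ⊆ (V : Set (QVA.OpSeries QVA.Scalars QVA.L₀)) ∧
          QVA.IsQVertexAlgebraOfFields QVA.qq V} QVA.xAlgebra ∧
      QVA.W₀ ≤ QVA.xAlgebra ∧
      -- the monomial basis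
      (∃ b : Module.Basis {l : List ℤ // QVA.Admissible l} QVA.Scalars QVA.W₀,
        ∀ l, (b l : QVA.OpSeries QVA.Scalars QVA.L₀) =
          QVA.monomial QVA.qq QVA.frenkelJing l) ∧
      -- normally ordered products with distinct shifts
      LinearIndependent QVA.Scalars QVA.normalOrdered :=
  ⟨QVA.isLeast_xAlgebra, QVA.W₀_le_xAlgebra, ⟨QVA.admissibleBasis, QVA.admissibleBasis_apply⟩,
    QVA.linearIndependent_normalOrdered⟩
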